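/- A *path* is the graph of a continuous function $[0,1]\to\mathbb R$. A *system of size $n\ge 3$* is a set of $n$ paths with pairwise distinct left endpoints and pairwise distinct right endpoints, such that any two paths meet in finitely many points and cross at each of them, and no three paths have a common point. It is labeled by $[n]=\{1,\dots,n\}$ in the order of the left endpoints from bottom to top. Its *associated tableau* is $T=(T(1),\dots,T(n))$, where $T(i)$ is the *local sequence* of path $i$, i.e. the sequence of the labels of the paths that path $i$ meets, from left to right. The *signature* of a system of size $3$ is the word on $\{x,y,z\}$ that lists its crossings from left to right, where a $\{1,2\}$-, $\{1,3\}$-, $\{2,3\}$-crossing is recorded as $x$, $y$, $z$ respectively. A system of size $n\ge 4$ is *regular with signature $\sigma$* if $\sigma\ne\emptyset$ and each of its subsystems of size $3$ (relabeled by $[3]$ in increasing order) has signature $\sigma$. A signature $\sigma$ is *extendable* if there is a regular system of size $4$ with signature $\sigma$. For a word $\tau$ let $X(\tau),Y(\tau),Z(\tau)$ be its numbers of $x$'s, $y$'s, $z$'s. A nonempty word $\sigma$ is *irreducible* if no nonempty proper initial substring $\tau$ of $\sigma$ has $X(\tau)=Y(\tau)=Z(\tau)$. Let $B_{(ab)}$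 be the set of words $a^rb^r$ and $b^ra^r$, let $B_{(cd)}$ be the set of words $c^rd^r$ and $d^rc^r$ ($r\in\mathbb N$), and let $B_{(ab,cd)}=B_{(ab)}\cup B_{(cd)}$. Let $W_{(ab,cd)}$ be the set of words in $B_{(ab,cd)}^\star$ that lie neither in $B_{(ab)}^\star$ nor in $B_{(cd)}^\star$, where $L^\star$ is the set of all concatenations of words in $L$. For $n\ge 3$ and $\omega=\omega_1\cdots\omega_k$ with $\omega_j\in B_{(ab,cd)}$, let $T^\omega_n$ be the tableau on $[n]$ whose $i$-th row is the concatenation $\phi_{i,n}(\omega_1)\cdots\phi_{i,n}(\omega_k)$, where $\phi_{i,n}(a^rb^r)=1^r2^r\cdots(i-1)^r$, $\phi_{i,n}(b^ra^r)=(i-1)^r\cdots2^r1^r$, $\phi_{i,n}(c^rd^r)=(i+1)^r\cdots n^r$ and $\phi_{i,n}(d^rc^r)=n^r\cdots(i+1)^r$ (this does not depend on the factorization of $\omega$). **Proposition.** Let $\sigma$ be an irreducible word that is the signature of a system of size $3$. Then $\sigma$ is extendable if and only if the following two conditions hold. 1. There is an $\omega\in W_{(ab,cd)}$ such that $T^\omega_3$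 is the tableau associated to a system (of size $3$) with signature $\sigma$. 2. $\sigma=\alpha\beta\gamma$ or $\sigma=\gamma\beta\alpha$ for words $\alpha,\beta,\gamma$ with $$\begin{pmatrix}X(\alpha)&Y(\alpha)&Z(\alpha)\\X(\beta)&Y(\beta)&Z(\beta)\\X(\gamma)&Y(\gamma)&Z(\gamma)\end{pmatrix}=\begin{pmatrix}p&p&0\\q&0&p\\0&q&q\end{pmatrix},$$ where $p,q$ are non-negative integers, not both equal to $0$. Furthermore, if $S$ is a regular system labeled by $[n]$ with signature $\sigma$, and $\omega\in W_{(ab,cd)}$ is a word as in condition 1, then $T^\omega_n$ is the tableau associated to $S$. -/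

import Mathlib

open scoped Computability

/-! ### Systems of paths -/

/-- Two real functions on `[0,1]` cross at the point `t`: their order just before `t` is the
opposite of their order just after `t`. -/
def CrossAt (f g : unitInterval → ℝ) (t : unitInterval) : Prop :=
  ((∀ᶠ s in nhdsWithin t (Set.Iio t), f s < g s) ∧
      (∀ᶠ s in nhdsWithin t (Set.Ioi t), g s < f s)) ∨
    ((∀ᶠ s in nhdsWithin t (Set.Iio t), g s < f s) ∧
      (∀ᶠ s in nhdsWithin t (Set.Ioi t), f s < g s))

/-- A system of `n` paths, `n ≥ 3`, labeled by `[n]` in the order of the left endpoints from bottom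
to top. The label `i + 1 ∈ [n] = {1, …, n}` is represented by `i : Fin n`, and each path is
given by the continuous function on `[0,1]` whose graph it is. -/
structure PathSystem (n : ℕ) where
  path : Fin n → C(unitInterval, ℝ)
  three_le : 3 ≤ n
  left_strictMono : StrictMono fun i => path i 0
  right_injective : Function.Injective fun i => path i 1
  finite_inter : ∀ i j, i ≠ j → {t | path i t = path j t}.Finite
  crossAt : ∀ i j, i ≠ j → ∀ t, path i t = path j t → CrossAt (path i) (path j) t
  no_triple : ∀ i j k, i ≠ j → i ≠ k → j ≠ k → ∀ t, ¬ (path i t = path j t ∧ path i t = path k t)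

namespace PathSystem

variable {n : ℕ}

/-- The subsystem formed by the paths `e 0 < e 1 < ⋯ < e (m - 1)`, labeled by `[m]`. -/
def restrict {m : ℕ} (S : PathSystem n) (hm : 3 ≤ m) (e : Fin m ↪o Fin n) : PathSystem m where
  path i := S.path (e i)
  three_le := hm
  left_strictMono := fun _ _ h => S.left_strictMono (e.strictMono h)
  right_injective := fun _ _ h => e.injective (S.right_injective h)
  finite_inter := fun _ _ h => S.finite_inter _ _ (e.injective.ne h)
  crossAt := fun _ _ h => S.crossAt _ _ (e.injective.ne h)
  no_triple := fun _ _ _ h₁ h₂ h₃ =>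
    S.no_triple _ _ _ (e.injective.ne h₁) (e.injective.ne h₂) (e.injective.ne h₃)

/-- The parameters `t ∈ [0,1]` at which some two paths of the system meet. -/
def crossingTimes (S : PathSystem n) : Set unitInterval :=
  {t | ∃ i j, i ≠ j ∧ S.path i t = S.path j t}

theorem finite_crossingTimes (S : PathSystem n) : S.crossingTimes.Finite := by
  have h : S.crossingTimes ⊆
      ⋃ p : Fin n × Fin n, {t | p.1 ≠ p.2 ∧ S.path p.1 t = S.path p.2 t} := by
    rintro t ⟨i, j, hij, ht⟩
    exact Set.mem_iUnion.2 ⟨(i, j), hij, ht⟩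
  refine (Set.finite_iUnion fun p => ?_).subset h
  by_cases hp : p.1 = p.2
  · simp [hp]
  · exact (S.finite_inter _ _ hp).subset fun t ht => ht.2

/-- The crossing times of the system, from left to right. -/
noncomputable def sortedTimes (S : PathSystem n) : List unitInterval :=
  S.finite_crossingTimes.toFinset.sort (· ≤ ·)

open Classical in
/-- The local sequence of path `i`: the labels of the paths met by path `i`, from left to right.
At each time path `i` meets at most one other path, since there are no triple points. -/
noncomputable def localSequence (S : PathSystem n) (i : Fin n) : List (Fin n) :=
  S.sortedTimes.flatMap fun t =>
    (List.finRange n).filter fun j => j ≠ i ∧ S.path i t = S.path j t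

end PathSystem

/-- A tableau on `[n]`, given by its rows; row `i` of the tableaux below never contains `i`. -/
abbrev Tableau (n : ℕ) : Type := Fin n → List (Fin n)

/-- The tableau associated to a system: its rows are the local sequences. -/
noncomputable def PathSystem.tableau {n : ℕ} (S : PathSystem n) : Tableau n :=
  fun i => S.localSequence i

/-! ### Signatures -/

/-- The alphabet `{x, y, z}` of signatures. -/
inductive XYZ
  | x
  | y
  | z
  deriving DecidableEq

namespace PathSystem

open Classical in
/-- The signature of a system of size 3: the crossings from left to right, where crossings of the
lowest two, the outer two and the highest two starting paths are recorded as `x`, `y` and `z`.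
At each time at most one pair crosses, since there are no triple points. -/
noncomputable def signature (S : PathSystem 3) : List XYZ :=
  S.sortedTimes.flatMap fun t =>
    (if S.path 0 t = S.path 1 t then [XYZ.x] else []) ++
      (if S.path 0 t = S.path 2 t then [XYZ.y] else []) ++
        (if S.path 1 t = S.path 2 t then [XYZ.z] else [])

variable {n : ℕ}

/-- A system is regular if it has size at least 4 and all its subsystems of size 3 have the same,
nonempty, signature. -/
def IsRegular (S : PathSystem n) : Prop :=
  4 ≤ n ∧ ∀ e e' : Fin 3 ↪o Fin n,
    (S.restrict le_rfl e).signature = (S.restrict le_rfl e').signature ∧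
      (S.restrict le_rfl e).signature ≠ []

/-- The system is regular, and `σ` is its signature, that is, the common signature of its
subsystems of size 3. -/
def IsRegularWithSignature (S : PathSystem n) (σ : List XYZ) : Prop :=
  S.IsRegular ∧ ∀ e : Fin 3 ↪o Fin n, (S.restrict le_rfl e).signature = σ

end PathSystem

/-- The word `σ` is the signature of some system of size 3. -/
def IsSignature (σ : List XYZ) : Prop := ∃ S : PathSystem 3, S.signature = σ

/-- There is a regular system of size 4 with signature `σ`. -/
def Extendable (σ : List XYZ) : Prop := ∃ S : PathSystem 4, S.IsRegularWithSignature σ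

/-- A nonempty word is irreducible if no nonempty proper initial substring contains each of the
three letters the same number of times. -/
def IrreducibleWord (σ : List XYZ) : Prop :=
  σ ≠ [] ∧ ¬ ∃ τ : List XYZ, τ <+: σ ∧ τ ≠ [] ∧ τ ≠ σ ∧
    τ.count XYZ.x = τ.count XYZ.y ∧ τ.count XYZ.y = τ.count XYZ.z

/-! ### Balanced words and their tableaux -/

/-- The alphabet `{a, b, c, d}`. -/
inductive ABCD
  | a
  | b
  | c
  | d
  deriving DecidableEq

/-- The four shapes of balanced blocks: `aʳbʳ`, `bʳaʳ`, `cʳdʳ`, `dʳcʳ`. -/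
inductive BlockShape
  | ab
  | ba
  | cd
  | dc

namespace BlockShape

/-- The first letter of a block. -/
def fst : BlockShape → ABCD
  | ab => ABCD.a
  | ba => ABCD.b
  | cd => ABCD.c
  | dc => ABCD.d

/-- The second letter of a block. -/
def snd : BlockShape → ABCD
  | ab => ABCD.b
  | ba => ABCD.a
  | cd => ABCD.d
  | dc => ABCD.c

/-- The balanced block of the given shape and size `r`, as a word. -/
def word (s : BlockShape) (r : ℕ) : List ABCD :=
  List.replicate r s.fst ++ List.replicate r s.snd

/-- Row `i` of the tableau on `[n]` of a block of size `r`: each smaller label (for the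
letters `a, b`) or each larger label (for the letters `c, d`), repeated `r` times,
in increasing order for `aʳbʳ`, `cʳdʳ` and in decreasing order for `bʳaʳ`, `dʳcʳ`. -/
def row (s : BlockShape) (r n : ℕ) (i : Fin n) : List (Fin n) :=
  match s with
  | ab => ((List.finRange n).filter fun j => j < i).flatMap (List.replicate r)
  | ba => ((List.finRange n).filter fun j => j < i).reverse.flatMap (List.replicate r)
  | cd => ((List.finRange n).filter fun j => i < j).flatMap (List.replicate r)
  | dc => ((List.finRange n).filter fun j => i < j).reverse.flatMap (List.replicate r)

end BlockShape

/-- Balanced blocks on `{a, b}`. -/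
def blocksAB : Language ABCD := {w | ∃ r, w = BlockShape.ab.word r ∨ w = BlockShape.ba.word r}

/-- Balanced blocks on `{c, d}`. -/
def blocksCD : Language ABCD := {w | ∃ r, w = BlockShape.cd.word r ∨ w = BlockShape.dc.word r}

/-- The language `W` of all concatenations of balanced blocks on `{a, b}` and on `{c, d}` that are
neither concatenations of balanced blocks on `{a, b}` alone nor of balanced blocks on `{c, d}`
alone. -/
def wordsW : Set (List ABCD) :=
  {ω | ω ∈ (blocksAB + blocksCD)∗ ∧ ω ∉ blocksAB∗ ∧ ω ∉ blocksCD∗}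

/-- The concatenation of a list of blocks, as a word. -/
def blocksWord (L : List (BlockShape × ℕ)) : List ABCD := L.flatMap fun B => B.1.word B.2

/-- The tableau of a list of blocks: the row-wise concatenation of the tableaux of the blocks. -/
def blocksTableau (n : ℕ) (L : List (BlockShape × ℕ)) : Tableau n :=
  fun i => L.flatMap fun B => B.1.row B.2 n i

open Classical in
/-- The tableau `T^ω_n` of a word `ω`: factor `ω` into balanced blocks and concatenate the tableaux
of the blocks. The result does not depend on the factorization, see `wordTableau_blocksWord`;
words that do not factor into balanced blocks get the empty tableau. -/
noncomputable def wordTableau (n : ℕ) (ω : List ABCD) : Tableau n :=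
  if h : ∃ L, blocksWord L = ω then blocksTableau n h.choose else fun _ => []

theorem mem_kstar_iff_exists_blocksWord (ω : List ABCD) :
    ω ∈ (blocksAB + blocksCD)∗ ↔ ∃ L, blocksWord L = ω := by
  have key : ∀ w, w ∈ blocksAB + blocksCD ↔ ∃ B : BlockShape × ℕ, w = B.1.word B.2 := by
    intro w
    rw [Language.mem_add]
    constructor
    · rintro (⟨r, h | h⟩ | ⟨r, h | h⟩) <;> exact ⟨(_, r), h⟩
    · rintro ⟨⟨s, r⟩, h⟩
      cases s
      · exact Or.inl ⟨r, Or.inl h⟩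
      · exact Or.inl ⟨r, Or.inr h⟩
      · exact Or.inr ⟨r, Or.inl h⟩
      · exact Or.inr ⟨r, Or.inr h⟩
  rw [Language.mem_kstar]
  constructor
  · rintro ⟨M, rfl, hM⟩
    induction M with
    | nil => exact ⟨[], rfl⟩
    | cons w M ih =>
      obtain ⟨L, hL⟩ := ih fun y hy => hM y (List.mem_cons_of_mem _ hy)
      obtain ⟨B, hB⟩ := (key w).1 (hM w List.mem_cons_self)
      refine ⟨B :: L, ?_⟩
      rw [List.flatten_cons, ← hL, hB]
      rfl
  · rintro ⟨L, rfl⟩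
    refine ⟨L.map fun B => B.1.word B.2, ?_, ?_⟩
    · simp [blocksWord, List.flatMap_def]
    · intro y hy
      obtain ⟨B, -, rfl⟩ := List.mem_map.1 hy
      exact (key _).2 ⟨B, rfl⟩

theorem BlockShape.fst_ne_snd (s : BlockShape) : s.fst ≠ s.snd := by cases s <;> decide

theorem BlockShape.fst_injective : Function.Injective BlockShape.fst := by
  intro s s' h; cases s <;> cases s' <;> first | rfl | cases h

theorem BlockShape.row_zero (s : BlockShape) (n : ℕ) (i : Fin n) : s.row 0 n i = [] := by
  cases s <;> simp [BlockShape.row]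

theorem replicate_append_cancel {α : Type*} {u v : α} (huv : u ≠ v) :
    ∀ {r r' : ℕ} {w w' : List α},
      List.replicate r u ++ v :: w = List.replicate r' u ++ v :: w' → r = r' ∧ w = w'
  | 0, 0, w, w', h => by simpa using h
  | 0, r' + 1, w, w', h => by
    simp only [List.replicate_succ, List.replicate_zero, List.nil_append, List.cons_append,
      List.cons.injEq] at h
    exact absurd h.1.symm huv
  | r + 1, 0, w, w', h => by
    simp only [List.replicate_succ, List.replicate_zero, List.nil_append, List.cons_append,
      List.cons.injEq] at h
    exact absurd h.1 huv
  | r + 1, r' + 1, w, w', h => by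
    simp only [List.replicate_succ, List.cons_append, List.cons.injEq, true_and] at h
    obtain ⟨h₁, h₂⟩ := replicate_append_cancel huv h
    exact ⟨by rw [h₁], h₂⟩

theorem blocksTableau_eq_of_blocksWord_eq (n : ℕ) (L L' : List (BlockShape × ℕ))
    (h : blocksWord L = blocksWord L') : blocksTableau n L = blocksTableau n L' := by
  have z : ∀ (s : BlockShape) (L : List (BlockShape × ℕ)),
      blocksWord ((s, 0) :: L) = blocksWord L ∧
        blocksTableau n ((s, 0) :: L) = blocksTableau n L := by
    intro s L
    refine ⟨by simp [blocksWord, BlockShape.word], ?_⟩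
    funext i
    simp [blocksTableau, BlockShape.row_zero]
  have c : ∀ (s : BlockShape) (r : ℕ) (L : List (BlockShape × ℕ)),
      blocksWord ((s, r + 1) :: L) =
        s.fst :: (List.replicate r s.fst ++ s.snd :: (List.replicate r s.snd ++ blocksWord L)) := by
    intro s r L
    simp [blocksWord, BlockShape.word, List.replicate_succ]
  induction L generalizing L' with
  | nil =>
    induction L' with
    | nil => rfl
    | cons B L' ih =>
      obtain ⟨s, _ | r⟩ := B
      · rw [(z s L').2]
        exact ih (h.trans (z s L').1)
      · rw [c] at h
        cases h
  | cons B L ih =>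
    obtain ⟨s, _ | r⟩ := B
    · rw [(z s L).2]
      exact ih L' ((z s L).1.symm.trans h)
    · induction L' with
      | nil =>
        rw [c] at h
        cases h
      | cons B' L' ih' =>
        obtain ⟨s', _ | r'⟩ := B'
        · rw [(z s' L').2]
          exact ih' (h.trans (z s' L').1)
        · rw [c, c, List.cons.injEq] at h
          obtain ⟨hs, h⟩ := h
          obtain rfl := BlockShape.fst_injective hs
          obtain ⟨rfl, h⟩ := replicate_append_cancel s.fst_ne_snd h
          have h' := ih L' (List.append_cancel_left h)
          funext i
          have hi := congrFun h' i
          simp only [blocksTableau, List.flatMap_cons] at hi ⊢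
          rw [hi]

theorem wordTableau_blocksWord (n : ℕ) (L : List (BlockShape × ℕ)) :
    wordTableau n (blocksWord L) = blocksTableau n L := by
  have h : ∃ L', blocksWord L' = blocksWord L := ⟨L, rfl⟩
  rw [wordTableau, dif_pos h]
  exact blocksTableau_eq_of_blocksWord_eq n _ _ h.choose_spec

/-- The word `ω` lies in `W`, and its tableau on `[3]` is the tableau associated to a system
with signature `σ`. -/
def IsAssociatedWord (σ : List XYZ) (ω : List ABCD) : Prop :=
  ω ∈ wordsW ∧ ∃ S : PathSystem 3, S.signature = σ ∧ S.tableau = wordTableau 3 ω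

/-- The `3 × 3` matrix of letter counts of three words: rows are words, columns are `x, y, z`. -/
def letterCounts (α β γ : List XYZ) : Matrix (Fin 3) (Fin 3) ℕ :=
  !![α.count XYZ.x, α.count XYZ.y, α.count XYZ.z;
     β.count XYZ.x, β.count XYZ.y, β.count XYZ.z;
     γ.count XYZ.x, γ.count XYZ.y, γ.count XYZ.z]

/-- The word `σ` factors as `αβγ` or `γβα` with the prescribed letter counts. -/
def HasTurnFactorization (σ : List XYZ) : Prop :=
  ∃ (α β γ : List XYZ) (p q : ℕ), (σ = α ++ β ++ γ ∨ σ = γ ++ β ++ α) ∧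
    ¬ (p = 0 ∧ q = 0) ∧ letterCounts α β γ = !![p, p, 0; q, 0, p; 0, q, q]

/-! Let V be the set of letter counts of the prefixes of `σ`, a monotone chain in ℕ³ from (0,0,0) to
(N,N,N). Number four paths 0, 1, 2, 3. The crossings of a regular system form a word on the pairs of
labels that restricts to `σ` on each of the four triples, so every prefix of this word gives four
pairwise comparable points of V. At a crossing of 0 and 1 the triples 012 and 013 take the same
`x`-step of V; hence (0,2) and (0,3) have equal counts, as do (1,2) and (1,3), and the triples 023
and 123 give points of V with two equal coordinates ("balanced" points). Crossings of 0 and 3, and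
of 2 and 3, behave alike. Irreducibility says that V meets the main diagonal only at its ends.
`RegularChain` collects these facts, and both conditions follow from it.

Condition 1: steps occur only at balanced coordinates, so the staircases that V projects to, which
are the rows of the tableau, split into balanced blocks (`RegularChain.block`,
`RegularChain.exists_blocks`). Condition 2: a balanced point (c,c,z) with 0 < c < N forces (c,c,0)
or (c,c,N) into V (`low_or_high_of_diag12`), and similarly for (x,c,c). From this `exists_turn`
finds p such that V contains (p,p,0) and (N,p,p), or (0,p,p) and (p,p,N); cutting `σ` at these two
points gives the factorization.

Conversely, the tableau of ω on four labels restricts on every triple to the rows αx^qy^q, x^pβz^q,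
y^pz^pγ of `σ` = αβγ. Delete from each row the first p occurrences of every smaller label and the
last q of every larger one, and concatenate the remaining rows: every triple reads αβγ
(`exists_regularWord_of_turn`). This word of crossings is realizable: as `σ` comes from a system,
the parities of the counts define a linear order of the paths after each prefix
(`isConsistent_signature`), and polygonal paths through the ranks cross one pair at a time
(`exists_pathSystem`).

The last claim holds because a list is determined by its restrictions to pairs of letters, so a
tableau is determined by its triples. -/

/-! ### Regular chains: balanced points and the two turning points -/

/-- The combinatorial properties of the set `V` of letter counts `(x, y, z)` of the prefixes of an
irreducible word, each letter of which occurs `N` times, that is the common restriction to triples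
of a word on the pairs of a four element set. -/
structure RegularChain (N : ℕ) (V : ℕ → ℕ → ℕ → Prop) : Prop where
  zero : V 0 0 0
  top : V N N N
  le : ∀ {x y z}, V x y z → x ≤ N ∧ y ≤ N ∧ z ≤ N
  cmp : ∀ {x y z x' y' z'}, V x y z → V x' y' z' →
    (x ≤ x' ∧ y ≤ y' ∧ z ≤ z') ∨ (x' ≤ x ∧ y' ≤ y ∧ z' ≤ z)
  diag : ∀ {c}, V c c c → c = 0 ∨ c = N
  -- Comes from a crossing of paths 0 and 1: the triples 012 and 013 make the step, and 023 and 123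
  -- give the two balanced points. `ystep` comes from the crossings of 0 and 3, `zstep` from those
  -- of 2 and 3.
  xstep : ∀ k < N, ∃ b c e, V k b c ∧ V (k + 1) b c ∧ V b b e ∧ V c c e
  ystep : ∀ k < N, ∃ a c e, V a k c ∧ V a (k + 1) c ∧ V a a e ∧ V e c c
  zstep : ∀ k < N, ∃ a b e, V a b k ∧ V a b (k + 1) ∧ V e a a ∧ V e b b
  -- Comes from a moment when path 0 has met each of the others exactly `c` times; the last point is
  -- that of the triple 123. `diag23` is the same for path 3.
  diag12 : ∀ {c z}, V c c z → ∃ a b d, V c c a ∧ V c c b ∧ V c c d ∧ V a b d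
  diag23 : ∀ {c x}, V x c c → ∃ a b d, V a c c ∧ V b c c ∧ V d c c ∧ V a b d

namespace RegularChain

variable {N : ℕ} {V : ℕ → ℕ → ℕ → Prop}

/-- The symmetry that turns the paths upside down. -/
theorem flip (h : RegularChain N V) : RegularChain N fun x y z => V z y x where
  zero := h.zero
  top := h.top
  le hv := by have := h.le hv; omega
  cmp hv hv' := by have := h.cmp hv hv'; omega
  diag hv := h.diag hv
  xstep k hk := by
    obtain ⟨a, b, e, h1, h2, h3, h4⟩ := h.zstep k hk
    exact ⟨b, a, e, h1, h2, h4, h3⟩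
  ystep k hk := by
    obtain ⟨a, c, e, h1, h2, h3, h4⟩ := h.ystep k hk
    exact ⟨c, a, e, h1, h2, h4, h3⟩
  zstep k hk := by
    obtain ⟨b, c, e, h1, h2, h3, h4⟩ := h.xstep k hk
    exact ⟨c, b, e, h1, h2, h4, h3⟩
  diag12 hv := by
    obtain ⟨a, b, d, h1, h2, h3, h4⟩ := h.diag23 hv
    exact ⟨d, b, a, h3, h2, h1, h4⟩
  diag23 hv := by
    obtain ⟨a, b, d, h1, h2, h3, h4⟩ := h.diag12 hv
    exact ⟨d, b, a, h3, h2, h1, h4⟩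

/-- The symmetry that reads the paths from right to left. -/
theorem reverse (h : RegularChain N V) :
    RegularChain N fun x y z => x ≤ N ∧ y ≤ N ∧ z ≤ N ∧ V (N - x) (N - y) (N - z) := by
  have key : ∀ {x y z}, V x y z → N - x ≤ N ∧ N - y ≤ N ∧ N - z ≤ N ∧
      V (N - (N - x)) (N - (N - y)) (N - (N - z)) := by
    intro x y z hv
    obtain ⟨hx, hy, hz⟩ := h.le hv
    rw [Nat.sub_sub_self hx, Nat.sub_sub_self hy, Nat.sub_sub_self hz]
    exact ⟨by omega, by omega, by omega, hv⟩
  refine ⟨?_, ?_, ?_, ?_, ?_, ?_, ?_, ?_, ?_, ?_⟩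
  · exact ⟨by omega, by omega, by omega, h.top⟩
  · simpa using h.zero
  · rintro x y z ⟨hx, hy, hz, -⟩
    exact ⟨hx, hy, hz⟩
  · rintro x y z x' y' z' ⟨hx, hy, hz, hv⟩ ⟨hx', hy', hz', hv'⟩
    have := h.cmp hv hv'
    omega
  · rintro c ⟨hc, -, -, hv⟩
    have := h.diag hv
    omega
  · intro k hk
    obtain ⟨b, c, e, h1, h2, h3, h4⟩ := h.xstep (N - (k + 1)) (by omega)
    have e1 : N - (N - (k + 1)) = k + 1 := by omega
    have e2 : N - (N - (k + 1) + 1) = k := by omega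
    have k1 := key h1
    have k2 := key h2
    refine ⟨N - b, N - c, N - e, ?_, ?_, key h3, key h4⟩
    · simpa only [e2] using k2
    · simpa only [e1] using k1
  · intro k hk
    obtain ⟨b, c, e, h1, h2, h3, h4⟩ := h.ystep (N - (k + 1)) (by omega)
    have e1 : N - (N - (k + 1)) = k + 1 := by omega
    have e2 : N - (N - (k + 1) + 1) = k := by omega
    have k1 := key h1
    have k2 := key h2
    refine ⟨N - b, N - c, N - e, ?_, ?_, key h3, key h4⟩
    · simpa only [e2] using k2
    · simpa only [e1] using k1
  · intro k hk
    obtain ⟨b, c, e, h1, h2, h3, h4⟩ := h.zstep (N - (k + 1)) (by omega)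
    have e1 : N - (N - (k + 1)) = k + 1 := by omega
    have e2 : N - (N - (k + 1) + 1) = k := by omega
    have k1 := key h1
    have k2 := key h2
    refine ⟨N - b, N - c, N - e, ?_, ?_, key h3, key h4⟩
    · simpa only [e2] using k2
    · simpa only [e1] using k1
  · rintro c z ⟨hc, -, hz, hv⟩
    obtain ⟨a, b, d, h1, h2, h3, h4⟩ := h.diag12 hv
    have e1 : N - (N - c) = c := by omega
    have k1 := key h1
    have k2 := key h2
    have k3 := key h3
    simp only [e1] at k1 k2 k3
    exact ⟨N - a, N - b, N - d, k1, k2, k3, key h4⟩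
  · rintro c z ⟨hc, hz, -, hv⟩
    obtain ⟨a, b, d, h1, h2, h3, h4⟩ := h.diag23 hv
    have e1 : N - (N - c) = c := by omega
    have k1 := key h1
    have k2 := key h2
    have k3 := key h3
    simp only [e1] at k1 k2 k3
    exact ⟨N - a, N - b, N - d, k1, k2, k3, key h4⟩

/-- Climbing from below `c` to above it with both other coordinates fixed at `c` would pass through
(c,c,c), which `diag` forbids. -/
theorem lt_of_diag12 (h : RegularChain N V) {c z z' : ℕ} (hc : 0 < c) (hcN : c < N)
    (hv : V c c z) (hz : z < c) (hv' : V c c z') : z' < c := by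
  by_contra hlt
  rcases (not_lt.1 hlt).lt_or_eq with hlt | rfl
  · obtain ⟨a, b, -, h1, h2, -, -⟩ := h.zstep c hcN
    have c1 := h.cmp hv h1
    have c2 := h.cmp h1 hv'
    obtain rfl : a = c := by omega
    obtain rfl : b = a := by omega
    have := h.diag h1
    omega
  · have := h.diag hv'
    omega

/-- `diag12` gives (a,b,d) and (c,c,d) in V with a, b, d < c. If d > 0, the steps of the first two
coordinates onto c happen at height d and yield (d,d,e₁) and (e₂,d,d) in V. These confine the
`z`-step onto d to y = d and d < x < c, and its balanced point (e,x,x) is incomparable with (c,c,d).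
-/
theorem low_of_diag12 (h : RegularChain N V) {c z : ℕ} (hc : 0 < c) (hcN : c < N)
    (hv : V c c z) (hz : z < c) : V c c 0 := by
  obtain ⟨a, b, d, ha, hb, hd, hv⟩ := h.diag12 hv
  have la := h.lt_of_diag12 hc hcN ‹_› hz ha
  have lb := h.lt_of_diag12 hc hcN ‹_› hz hb
  have ld := h.lt_of_diag12 hc hcN ‹_› hz hd
  rcases Nat.eq_zero_or_pos d with rfl | hd0
  · exact hd
  exfalso
  have c1 := h.cmp hv ha
  have c2 := h.cmp hv hb
  have hne : d < a ∨ d < b := by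
    by_contra hne
    obtain rfl : a = d := by omega
    obtain rfl : b = a := by omega
    have := h.diag hv
    omega
  obtain ⟨y1, z1, e1, h1, h2, -, h3⟩ := h.xstep (c - 1) (by omega)
  rw [Nat.sub_add_cancel hc] at h2
  have c3 := h.cmp hv h2
  have c4 := h.cmp h1 hd
  obtain rfl : z1 = d := by omega
  obtain ⟨x1, z2, e2, k1, k2, -, k3⟩ := h.ystep (c - 1) (by omega)
  rw [Nat.sub_add_cancel hc] at k2
  have c5 := h.cmp hv k2
  have c6 := h.cmp k1 hd
  obtain rfl : z2 = z1 := by omega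
  have c7 := h.cmp h3 hv
  have hlt : e1 < z2 := by
    rcases Nat.lt_or_ge e1 z2 with hlt | hge
    · exact hlt
    · obtain rfl : e1 = z2 := by omega
      have := h.diag h3
      omega
  obtain ⟨p, q, e, p1, p2, p3, -⟩ := h.zstep (z2 - 1) (by omega)
  rw [Nat.sub_add_cancel hd0] at p2
  have c8 := h.cmp h3 p2
  have c9 := h.cmp p1 hv
  have c10 := h.cmp p1 k3
  obtain rfl : q = z2 := by omega
  have hpq : p ≠ q := by
    rintro rfl
    have := h.diag p2
    omega
  have c11 := h.cmp p3 hd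
  omega

theorem low_or_high_of_diag12 (h : RegularChain N V) {c z : ℕ} (hc : 0 < c) (hcN : c < N)
    (hv : V c c z) : V c c 0 ∨ V c c N := by
  rcases lt_trichotomy z c with hz | rfl | hz
  · exact Or.inl (h.low_of_diag12 hc hcN hv hz)
  · have := h.diag hv
    omega
  · have hz' := (h.le hv).2.2
    have e1 : N - (N - c) = c := by omega
    have := h.reverse.low_of_diag12 (c := N - c) (z := N - z) (by omega) (by omega)
      ⟨by omega, by omega, by omega, by rwa [e1, Nat.sub_sub_self hz']⟩ (by omega)
    obtain ⟨-, -, -, this⟩ := this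
    rw [e1] at this
    exact Or.inr this

theorem low_or_high_of_diag23 (h : RegularChain N V) {c x : ℕ} (hc : 0 < c) (hcN : c < N)
    (hv : V x c c) : V N c c ∨ V 0 c c :=
  (h.flip.low_or_high_of_diag12 hc hcN hv).symm

/-- Take the largest p with (p,p,0) and the smallest d with (N,d,d) in V. If p = d this is the turn.
Otherwise p < d, and balanced values avoid the range between p and N for the first two coordinates,
and between 0 and d for the last two; the extreme steps of the chain then have no place. The second
alternative of the conclusion is needed only for p = 0, d = N. -/
theorem turn_of_low (h : RegularChain N V)
    (hR : ∀ c z, 0 < c → c < N → V c c z → V c c 0)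
    (hS : ∀ c x, 0 < c → c < N → V x c c → V N c c) :
    ∃ p ≤ N, (V p p 0 ∧ V N p p) ∨ (V 0 p p ∧ V p p N) := by
  classical
  by_contra hno
  push Not at hno
  obtain ⟨p, hpV, hpmax⟩ : ∃ p, V p p 0 ∧ ∀ c, V c c 0 → c ≤ p := by
    have hb : ∀ c, V c c 0 → c ≤ N := fun c hc => (h.le hc).1
    exact ⟨Nat.findGreatest (fun c => V c c 0) N,
      Nat.findGreatest_spec (P := fun c => V c c 0) (Nat.zero_le N) h.zero,
      fun c hc => Nat.le_findGreatest (hb c hc) hc⟩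
  obtain ⟨d, hdV, hdmin⟩ : ∃ d, V N d d ∧ ∀ c, V N c c → d ≤ c := by
    have hex : ∃ d, V N d d := ⟨N, h.top⟩
    exact ⟨Nat.find hex, Nat.find_spec hex, fun c hc => Nat.find_min' hex hc⟩
  have hpN := (h.le hpV).1
  have hdN := (h.le hdV).2.1
  have hR' : ∀ {c z}, V c c z → c ≤ p ∨ c = N := by
    intro c z hc
    have := (h.le hc).1
    rcases Nat.eq_zero_or_pos c with rfl | h0
    · exact Or.inl (Nat.zero_le _)
    · rcases this.lt_or_eq with h1 | h1
      · exact Or.inl (hpmax _ (hR c z h0 h1 hc))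
      · exact Or.inr h1
  have hS' : ∀ {c x}, V x c c → c = 0 ∨ d ≤ c := by
    intro c x hc
    have := (h.le hc).2.1
    rcases Nat.eq_zero_or_pos c with rfl | h0
    · exact Or.inl rfl
    · rcases this.lt_or_eq with h1 | h1
      · exact Or.inr (hdmin _ (hS c x h0 h1 hc))
      · exact Or.inr (by omega)
  have hne : p ≠ d := by
    rintro rfl
    exact (hno p hpN).1 hpV hdV
  have hc := h.cmp hpV hdV
  have hpN' : p ≠ N := by
    rintro rfl
    exact (hno p le_rfl).1 hpV h.top
  have hpd : p < d := by omega
  obtain ⟨a, b, e, z1, z2, z3, z4⟩ := h.zstep 0 (by omega)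
  obtain ⟨b', c', e', x1, x2, x3, x4⟩ := h.xstep (N - 1) (by omega)
  rw [Nat.sub_add_cancel (show 1 ≤ N by omega)] at x2
  have ra := hS' z3
  have rb := hS' z4
  have rb' := hR' x3
  have rc' := hR' x4
  have b1 := h.le z1
  have b2 := h.le x1
  rcases Nat.eq_zero_or_pos p with rfl | hp
  · rcases hdN.lt_or_eq with hlt | rfl
    · have := h.cmp x1 hdV
      obtain rfl : b' = 0 := by omega
      obtain rfl : c' = 0 := by omega
      have := hdmin _ x2
      omega
    -- Now p = 0 and d = N, so balanced values are 0 or N. Without a turn, the first `z`-step is at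
    -- x = 0 and the last at x = N. The last `x`-step comes after the one and before the other, so
    -- its `z`-value is neither 0 nor N.
    · obtain ⟨a'', b'', e'', w1, w2, w3, w4⟩ := h.zstep (d - 1) (by omega)
      rw [Nat.sub_add_cancel (show 1 ≤ d by omega)] at w2
      have ra'' := hS' w3
      have rb'' := hS' w4
      have b3 := h.le w1
      have n1 : ¬ V 0 0 d := (hno 0 (by omega)).2 h.zero
      have n2 : ¬ V 0 d d := fun hv => (hno d le_rfl).2 hv h.top
      have n3 : ¬ V d 0 0 := (hno 0 (by omega)).1 h.zero
      have n4 : ¬ V d d 0 := fun hv => (hno d le_rfl).1 hv h.top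
      have ha : a = 0 := by
        by_contra ha
        obtain rfl : a = d := by omega
        rcases rb with rfl | rb
        · exact n3 z1
        · obtain rfl : b = a := by omega
          exact n4 z1
      have ha'' : a'' = d := by
        by_contra ha''
        obtain rfl : a'' = 0 := by omega
        rcases rb'' with rfl | rb''
        · exact n1 w2
        · obtain rfl : b'' = d := by omega
          exact n2 w2
      subst ha ha''
      have c1 := h.cmp z2 x2
      have c2 := h.cmp x1 w1
      omega
  · have c1 := h.cmp hpV z2
    have ha : d ≤ a := by omega
    have hb : d ≤ b := by omega
    rcases hdN.lt_or_eq with hlt | rfl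
    · have c2 := h.cmp x1 hdV
      have hb' : b' = p := by
        have := h.cmp hpV x2
        omega
      subst hb'
      -- The `y`-step leaving p is squeezed to x = N, z = 0. Its balanced points (N,N,f) and
      -- (f,0,0), compared with (N,d,d) and (p,p,0), give d ≤ f ≤ p.
      obtain ⟨s, t, f, y1, y2, y3, y4⟩ := h.ystep b' (by omega)
      have c3 := h.cmp x2 y2
      have c4 := h.cmp y1 z1
      have b3 := h.le y1
      obtain rfl : s = N := by omega
      obtain rfl : t = 0 := by omega
      have c5 := h.cmp y3 hdV
      have c6 := h.cmp y4 hpV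
      omega
    · obtain rfl : a = d := by omega
      obtain rfl : b = a := by omega
      have := hpmax _ z1
      omega

/-- The extremes (c,c,0) and (N,c,c) form one family, (c,c,N) and (0,c,c) the other, and members of
different families cannot coexist in V. So all interior balanced points choose the same family, and
`flip` exchanges the two. -/
theorem exists_turn (h : RegularChain N V) :
    ∃ p ≤ N, (V p p 0 ∧ V N p p) ∨ (V 0 p p ∧ V p p N) := by
  rcases Nat.eq_zero_or_pos N with rfl | hN
  · exact ⟨0, le_rfl, Or.inl ⟨h.zero, h.zero⟩⟩
  by_cases hlow : (∀ c z, 0 < c → c < N → V c c z → V c c 0) ∧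
      (∀ c x, 0 < c → c < N → V x c c → V N c c)
  · exact h.turn_of_low hlow.1 hlow.2
  have hRS : ∀ c d, 0 < c → c < N → 0 < d → d < N →
      ¬ (V c c 0 ∧ V 0 d d) ∧ ¬ (V c c N ∧ V N d d) ∧ ¬ (V c c 0 ∧ V d d N) ∧
        ¬ (V N c c ∧ V 0 d d) := by
    intro c d hc hcN hd hdN
    refine ⟨?_, ?_, ?_, ?_⟩
    · rintro ⟨h1, h2⟩
      have := h.cmp h1 h2
      omega
    · rintro ⟨h1, h2⟩
      have := h.cmp h1 h2
      omega
    -- The first `z`-step lies between (c,c,0) and (d,d,N), at some x = a with 0 < a < N. The point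
    -- (e,a,a) it yields forces (N,a,a) or (0,a,a) into V; the former is incomparable with (d,d,N),
    -- the latter with (c,c,0).
    · rintro ⟨h1, h2⟩
      obtain ⟨a, b, e, z1, z2, z3, -⟩ := h.zstep 0 hN
      have c1 := h.cmp h1 z2
      have c2 := h.cmp z1 h2
      have c3 := h.cmp h1 h2
      rcases h.low_or_high_of_diag23 (by omega) (by omega) z3 with hv | hv
      · have := h.cmp hv h2
        omega
      · have := h.cmp hv h1
        omega
    · rintro ⟨h1, h2⟩
      obtain ⟨a, b, e, z1, z2, z3, -⟩ := h.xstep 0 hN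
      have c1 := h.cmp h2 z2
      have c2 := h.cmp z1 h1
      rcases h.low_or_high_of_diag12 (by omega) (by omega) z3 with hv | hv
      · have := h.cmp hv h2
        omega
      · have := h.cmp hv h1
        omega
  have hhigh : (∀ c z, 0 < c → c < N → V c c z → V c c N) ∧
      (∀ c x, 0 < c → c < N → V x c c → V 0 c c) := by
    by_contra hhigh
    apply hlow
    rw [not_and_or] at hhigh
    have hex : (∃ c, 0 < c ∧ c < N ∧ V c c 0) ∨ ∃ c, 0 < c ∧ c < N ∧ V N c c := by
      rcases hhigh with hh | hh <;> push Not at hh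
      · obtain ⟨c, z, h0, h1, h2, h3⟩ := hh
        exact Or.inl ⟨c, h0, h1, (h.low_or_high_of_diag12 h0 h1 h2).resolve_right h3⟩
      · obtain ⟨c, z, h0, h1, h2, h3⟩ := hh
        exact Or.inr ⟨c, h0, h1, (h.low_or_high_of_diag23 h0 h1 h2).resolve_right h3⟩
    rcases hex with ⟨c, h0, h1, hv⟩ | ⟨c, h0, h1, hv⟩
    · refine ⟨fun d z g0 g1 g2 => (h.low_or_high_of_diag12 g0 g1 g2).resolve_right fun hh =>
        (hRS c d h0 h1 g0 g1).2.2.1 ⟨hv, hh⟩, fun d z g0 g1 g2 =>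
        (h.low_or_high_of_diag23 g0 g1 g2).resolve_right fun hh =>
        (hRS c d h0 h1 g0 g1).1 ⟨hv, hh⟩⟩
    · refine ⟨fun d z g0 g1 g2 => (h.low_or_high_of_diag12 g0 g1 g2).resolve_right fun hh =>
        (hRS d c g0 g1 h0 h1).2.1 ⟨hh, hv⟩, fun d z g0 g1 g2 =>
        (h.low_or_high_of_diag23 g0 g1 g2).resolve_right fun hh =>
        (hRS c d h0 h1 g0 g1).2.2.2 ⟨hv, hh⟩⟩
  obtain ⟨p, hp, hcase⟩ := h.flip.turn_of_low
    (fun c z h0 h1 hv => hhigh.2 c z h0 h1 hv) (fun c z h0 h1 hv => hhigh.1 c z h0 h1 hv)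
  refine ⟨p, hp, ?_⟩
  tauto

end RegularChain

/-! ### Rows as projections of the chain, and their decomposition into balanced blocks -/

/-- The point `(x, y, z)` lists the letter counts of some prefix of `σ`. -/
def Visits (σ : List XYZ) (x y z : ℕ) : Prop :=
  ∃ τ, τ <+: σ ∧ τ.count XYZ.x = x ∧ τ.count XYZ.y = y ∧ τ.count XYZ.z = z

theorem visits_cmp {σ : List XYZ} {x y z x' y' z' : ℕ} (h : Visits σ x y z)
    (h' : Visits σ x' y' z') :
    (x ≤ x' ∧ y ≤ y' ∧ z ≤ z') ∨ (x' ≤ x ∧ y' ≤ y ∧ z' ≤ z) := by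
  obtain ⟨τ, hτ, rfl, rfl, rfl⟩ := h
  obtain ⟨τ', hτ', rfl, rfl, rfl⟩ := h'
  rcases List.prefix_or_prefix_of_prefix hτ hτ' with hp | hp
  · exact Or.inl ⟨hp.count_le _, hp.count_le _, hp.count_le _⟩
  · exact Or.inr ⟨hp.count_le _, hp.count_le _, hp.count_le _⟩

section TwoLetters

variable {β : Type*} {f : XYZ → Option β} {l₁ l₂ : XYZ} {v₁ v₂ : β}

theorem length_filterMap_two (hl : l₁ ≠ l₂)
    (hf : ∀ l, f l = if l = l₁ then some v₁ else if l = l₂ then some v₂ else none)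
    (s : List XYZ) : (s.filterMap f).length = s.count l₁ + s.count l₂ := by
  induction s with
  | nil => rfl
  | cons l s ih =>
    rw [List.filterMap_cons, hf, List.count_cons, List.count_cons]
    by_cases h1 : l = l₁
    · subst h1
      simp [ih, hl]
      omega
    · by_cases h2 : l = l₂
      · subst h2
        simp [ih, h1]
        omega
      · simp [ih, h1, h2]

theorem filterMap_two_eq_replicate (hl : l₁ ≠ l₂)
    (hf : ∀ l, f l = if l = l₁ then some v₁ else if l = l₂ then some v₂ else none)
    (s : List XYZ) (hs : s.count l₂ = 0) :
    s.filterMap f = List.replicate (s.count l₁) v₁ := by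
  induction s with
  | nil => rfl
  | cons l s ih =>
    rw [List.count_cons] at hs
    have ih := ih (by omega)
    have h2 : l ≠ l₂ := by
      rintro rfl
      simp at hs
    rw [List.filterMap_cons, hf, List.count_cons]
    by_cases h1 : l = l₁
    · simp [ih, h1, List.replicate_succ]
    · simp [ih, h1, h2]

/-- A row is the projection of the chain to two coordinates, so two visited points that agree in one
of these and differ by `k` in the other locate a run of `k` equal letters. -/
theorem drop_filterMap_two (hl : l₁ ≠ l₂)
    (hf : ∀ l, f l = if l = l₁ then some v₁ else if l = l₂ then some v₂ else none)
    {σ τ τ' : List XYZ} (hτ : τ <+: σ) (hτ' : τ' <+: σ) (k : ℕ)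
    (h₁ : τ'.count l₁ = τ.count l₁ + k) (h₂ : τ'.count l₂ = τ.count l₂) :
    (σ.filterMap f).drop (τ.count l₁ + τ.count l₂) =
      List.replicate k v₁ ++ (σ.filterMap f).drop (τ.count l₁ + k + τ.count l₂) := by
  have key : ∀ τ : List XYZ, τ <+: σ → ∃ ρ, σ = τ ++ ρ ∧
      (σ.filterMap f).drop (τ.count l₁ + τ.count l₂) = ρ.filterMap f := by
    rintro τ ⟨ρ, rfl⟩
    refine ⟨ρ, rfl, ?_⟩
    rw [List.filterMap_append, ← length_filterMap_two hl hf, List.drop_left]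
  rw [← h₁]
  obtain ⟨ρ, hρ, h3⟩ := key τ hτ
  obtain ⟨ρ', hρ', h4⟩ := key τ' hτ'
  rw [h₂] at h4
  rw [h3, h4]
  rcases List.prefix_or_prefix_of_prefix hτ hτ' with ⟨s, rfl⟩ | ⟨s, rfl⟩
  · rw [List.count_append] at h₁ h₂
    obtain rfl : ρ = s ++ ρ' := by simpa [hρ] using hρ'
    rw [List.filterMap_append, filterMap_two_eq_replicate hl hf s (by omega)]
    congr 2
    omega
  · rw [List.count_append] at h₁ h₂
    obtain rfl : ρ' = s ++ ρ := by simpa [hρ'] using hρ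
    rw [List.filterMap_append, filterMap_two_eq_replicate hl hf s (by omega)]
    obtain rfl : k = 0 := by omega
    obtain h0 : s.count l₁ = 0 := by omega
    simp [h0]

end TwoLetters

/-- Row `i` of the tableau of a system of size 3, letter by letter in terms of its signature. -/
def sigRow : Fin 3 → XYZ → Option (Fin 3)
  | 0, XYZ.x => some 1
  | 0, XYZ.y => some 2
  | 0, XYZ.z => none
  | 1, XYZ.x => some 0
  | 1, XYZ.y => none
  | 1, XYZ.z => some 2
  | 2, XYZ.x => none
  | 2, XYZ.y => some 0
  | 2, XYZ.z => some 1

theorem BlockShape.row_three_cd (r : ℕ) :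
    BlockShape.cd.row r 3 0 = List.replicate r 1 ++ List.replicate r 2 ∧
      BlockShape.cd.row r 3 1 = List.replicate r 2 ∧ BlockShape.cd.row r 3 2 = [] := by
  refine ⟨?_, ?_, ?_⟩ <;> simp [BlockShape.row, List.finRange_succ]

theorem BlockShape.row_three_dc (r : ℕ) :
    BlockShape.dc.row r 3 0 = List.replicate r 2 ++ List.replicate r 1 ∧
      BlockShape.dc.row r 3 1 = List.replicate r 2 ∧ BlockShape.dc.row r 3 2 = [] := by
  refine ⟨?_, ?_, ?_⟩ <;> simp [BlockShape.row, List.finRange_succ]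

theorem BlockShape.row_three_ab (r : ℕ) :
    BlockShape.ab.row r 3 0 = [] ∧ BlockShape.ab.row r 3 1 = List.replicate r 0 ∧
      BlockShape.ab.row r 3 2 = List.replicate r 0 ++ List.replicate r 1 := by
  refine ⟨?_, ?_, ?_⟩ <;> simp [BlockShape.row, List.finRange_succ]

theorem BlockShape.row_three_ba (r : ℕ) :
    BlockShape.ba.row r 3 0 = [] ∧ BlockShape.ba.row r 3 1 = List.replicate r 0 ∧
      BlockShape.ba.row r 3 2 = List.replicate r 1 ++ List.replicate r 0 := by
  refine ⟨?_, ?_, ?_⟩ <;> simp [BlockShape.row, List.finRange_succ]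

section Drop

variable {σ : List XYZ} {a b c a' b' c' : ℕ} (k : ℕ)

theorem drop_sigRow_zero_x (h : Visits σ a b c) (h' : Visits σ (a + k) b c') :
    (σ.filterMap (sigRow 0)).drop (a + b) =
      List.replicate k 1 ++ (σ.filterMap (sigRow 0)).drop (a + k + b) := by
  obtain ⟨τ, hτ, rfl, rfl, rfl⟩ := h
  obtain ⟨τ', hτ', h1, h2, -⟩ := h'
  exact drop_filterMap_two (l₁ := .x) (l₂ := .y) (v₂ := 2) (by decide)
    (by rintro (_ | _ | _) <;> rfl) hτ hτ' k h1 h2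

theorem drop_sigRow_zero_y (h : Visits σ a b c) (h' : Visits σ a (b + k) c') :
    (σ.filterMap (sigRow 0)).drop (a + b) =
      List.replicate k 2 ++ (σ.filterMap (sigRow 0)).drop (a + (b + k)) := by
  obtain ⟨τ, hτ, rfl, rfl, rfl⟩ := h
  obtain ⟨τ', hτ', h1, h2, -⟩ := h'
  rw [add_comm, add_comm _ (_ + k)]
  exact drop_filterMap_two (l₁ := .y) (l₂ := .x) (v₂ := 1) (by decide)
    (by rintro (_ | _ | _) <;> rfl) hτ hτ' k h2 h1

theorem drop_sigRow_one_x (h : Visits σ a b c) (h' : Visits σ (a + k) b' c) :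
    (σ.filterMap (sigRow 1)).drop (a + c) =
      List.replicate k 0 ++ (σ.filterMap (sigRow 1)).drop (a + k + c) := by
  obtain ⟨τ, hτ, rfl, rfl, rfl⟩ := h
  obtain ⟨τ', hτ', h1, -, h2⟩ := h'
  exact drop_filterMap_two (l₁ := .x) (l₂ := .z) (v₂ := 2) (by decide)
    (by rintro (_ | _ | _) <;> rfl) hτ hτ' k h1 h2

theorem drop_sigRow_one_z (h : Visits σ a b c) (h' : Visits σ a b' (c + k)) :
    (σ.filterMap (sigRow 1)).drop (a + c) =
      List.replicate k 2 ++ (σ.filterMap (sigRow 1)).drop (a + (c + k)) := by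
  obtain ⟨τ, hτ, rfl, rfl, rfl⟩ := h
  obtain ⟨τ', hτ', h1, -, h2⟩ := h'
  rw [add_comm, add_comm _ (_ + k)]
  exact drop_filterMap_two (l₁ := .z) (l₂ := .x) (v₂ := 0) (by decide)
    (by rintro (_ | _ | _) <;> rfl) hτ hτ' k h2 h1

theorem drop_sigRow_two_y (h : Visits σ a b c) (h' : Visits σ a' (b + k) c) :
    (σ.filterMap (sigRow 2)).drop (b + c) =
      List.replicate k 0 ++ (σ.filterMap (sigRow 2)).drop (b + k + c) := by
  obtain ⟨τ, hτ, rfl, rfl, rfl⟩ := h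
  obtain ⟨τ', hτ', -, h1, h2⟩ := h'
  exact drop_filterMap_two (l₁ := .y) (l₂ := .z) (v₂ := 1) (by decide)
    (by rintro (_ | _ | _) <;> rfl) hτ hτ' k h1 h2

theorem drop_sigRow_two_z (h : Visits σ a b c) (h' : Visits σ a' b (c + k)) :
    (σ.filterMap (sigRow 2)).drop (b + c) =
      List.replicate k 1 ++ (σ.filterMap (sigRow 2)).drop (b + (c + k)) := by
  obtain ⟨τ, hτ, rfl, rfl, rfl⟩ := h
  obtain ⟨τ', hτ', -, h1, h2⟩ := h'
  rw [add_comm, add_comm _ (_ + k)]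
  exact drop_filterMap_two (l₁ := .z) (l₂ := .y) (v₂ := 0) (by decide)
    (by rintro (_ | _ | _) <;> rfl) hτ hτ' k h2 h1

end Drop

namespace RegularChain

variable {N : ℕ} {V : ℕ → ℕ → ℕ → Prop}

/-- From a common corner of the three staircases, either `z` or `x` is the next letter other
than `y`. -/
theorem next_xz (h : RegularChain N V) {r s y : ℕ} (hv : V s y r) (hne : ¬ (r = N ∧ s = N)) :
    (r < N ∧ ∃ b, V s b r ∧ V s b (r + 1)) ∨ (s < N ∧ ∃ b, V s b r ∧ V (s + 1) b r) := by
  have hle := h.le hv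
  by_cases hr : r < N
  · obtain ⟨a, b, -, h1, h2, -, -⟩ := h.zstep r hr
    have c1 := h.cmp hv h2
    have l1 := h.le h1
    rcases Nat.lt_or_ge s a with hlt | hge
    · right
      obtain ⟨b', c', -, k1, k2, -, -⟩ := h.xstep s (by omega)
      have c2 := h.cmp k1 h1
      have c3 := h.cmp hv k2
      obtain rfl : c' = r := by omega
      exact ⟨by omega, b', k1, k2⟩
    · obtain rfl : a = s := by omega
      exact Or.inl ⟨hr, b, h1, h2⟩
  · right
    obtain ⟨b', c', -, k1, k2, -, -⟩ := h.xstep s (by omega)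
    have c3 := h.cmp hv k2
    have l1 := h.le k1
    obtain rfl : c' = r := by omega
    exact ⟨by omega, b', k1, k2⟩

/-- After a balanced point the staircase of the first row runs along a balanced block. -/
theorem block (h : RegularChain N V) {r s b ζ : ℕ} (hr : V r r ζ) (hrN : r < N)
    (hv : V s b (r + 1)) :
    ∃ k, 0 < k ∧ r + k ≤ N ∧ (∃ ζ', V (r + k) (r + k) ζ') ∧ (∃ η, V s η (r + k)) ∧
      ((∃ ζ', V (r + k) r ζ') ∨ ∃ ζ', V r (r + k) ζ') := by
  classical
  have hex : ∃ k, 0 < k ∧ r + k ≤ N ∧ ∃ ζ', V (r + k) (r + k) ζ' :=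
    ⟨N - r, by omega, by omega, N, by rw [Nat.add_sub_cancel' hrN.le]; exact h.top⟩
  obtain ⟨k, ⟨hk, hkN, ζ', hζ'⟩, hmin⟩ : ∃ k, (0 < k ∧ r + k ≤ N ∧ ∃ ζ', V (r + k) (r + k) ζ') ∧
      ∀ c ζ', V c c ζ' → r < c → r + k ≤ c := by
    refine ⟨Nat.find hex, Nat.find_spec hex, fun c ζ' hc hrc => ?_⟩
    have := Nat.find_min' hex (m := c - r)
      ⟨by omega, by have := h.le hc; omega, ζ', by rwa [Nat.add_sub_cancel' hrc.le]⟩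
    omega
  refine ⟨k, hk, hkN, ⟨ζ', hζ'⟩, ?_, ?_⟩
  -- If the `z`-step onto r + k had x > s, the `x`-step leaving s would occur at a `z`-value c
  -- strictly between r and r + k, and `xstep` would make (c,c,e) a balanced point, against the
  -- minimality of k.
  · obtain ⟨a, b', -, h1, h2, -, -⟩ := h.zstep (r + k - 1) (by omega)
    rw [Nat.sub_add_cancel (by omega : 1 ≤ r + k)] at h2
    have c1 := h.cmp hv h2
    have l1 := h.le h1
    have l2 := h.le hv
    rcases Nat.lt_or_ge s a with hlt | hge
    · exfalso
      obtain ⟨b'', c, e, k1, k2, -, k3⟩ := h.xstep s (by omega)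
      have c2 := h.cmp hv k2
      have c3 := h.cmp k1 h1
      have := hmin c e k3 (by omega)
      omega
    · have : a = s ∨ (k = 1 ∧ a ≤ s) := by omega
      rcases this with rfl | ⟨rfl, -⟩
      · exact ⟨_, h2⟩
      · exact ⟨_, hv⟩
  -- The `x`-step leaving r occurs at a balanced `y`-value, which by minimality is r or r + k. If it
  -- is r, the `y`-step leaving r occurs at x = r + k by the same argument.
  · obtain ⟨b', c, e, h1, h2, h3, -⟩ := h.xstep r hrN
    have c1 := h.cmp hr h2
    have c2 := h.cmp h1 hζ'
    rcases Nat.lt_or_ge r b' with hlt | hge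
    · have := hmin b' e h3 hlt
      obtain rfl : b' = r + k := by omega
      exact Or.inr ⟨_, h1⟩
    · obtain rfl : b' = r := by omega
      obtain ⟨a, c', e', k1, k2, k3, -⟩ := h.ystep b' hrN
      have c3 := h.cmp h2 k2
      have c4 := h.cmp k1 hζ'
      have := hmin a e' k3 (by omega)
      obtain rfl : a = b' + k := by omega
      exact Or.inl ⟨_, k1⟩

/-- The three rows are read from the positions (r,r), (s,r), (s,s) of their staircases. A block of
type `cd` or `dc` advances `r`, one of type `ab` or `ba` advances `s`; that (s,η,r) is visited keeps
the middle row in step with the outer two. -/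
theorem exists_blocks_drop {σ : List XYZ} (h : RegularChain N (Visits σ)) :
    ∀ m r s ζ ξ η : ℕ, (N - r) + (N - s) ≤ m → Visits σ r r ζ → Visits σ ξ s s → Visits σ s η r →
      ∃ L : List (BlockShape × ℕ),
        blocksTableau 3 L 0 = (σ.filterMap (sigRow 0)).drop (r + r) ∧
        blocksTableau 3 L 1 = (σ.filterMap (sigRow 1)).drop (s + r) ∧
        blocksTableau 3 L 2 = (σ.filterMap (sigRow 2)).drop (s + s) := by
  have hcons : ∀ (sh : BlockShape) (k : ℕ) (L : List (BlockShape × ℕ)) (i : Fin 3),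
      blocksTableau 3 ((sh, k) :: L) i = sh.row k 3 i ++ blocksTableau 3 L i := fun _ _ _ _ => rfl
  intro m
  induction m with
  | zero =>
    intro r s ζ ξ η hm hr hs hv
    have l1 := h.le hv
    obtain rfl : r = N := by omega
    obtain rfl : s = r := by omega
    have hσ := h.le (⟨σ, List.prefix_rfl, rfl, rfl, rfl⟩ : Visits σ _ _ _)
    refine ⟨[], ?_, ?_, ?_⟩
    · refine (List.drop_eq_nil_of_le ?_).symm
      rw [length_filterMap_two (l₁ := .x) (l₂ := .y) (v₁ := 1) (v₂ := 2) (by decide)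
        (by rintro (_ | _ | _) <;> rfl)]
      omega
    · refine (List.drop_eq_nil_of_le ?_).symm
      rw [length_filterMap_two (l₁ := .x) (l₂ := .z) (v₁ := 0) (v₂ := 2) (by decide)
        (by rintro (_ | _ | _) <;> rfl)]
      omega
    · refine (List.drop_eq_nil_of_le ?_).symm
      rw [length_filterMap_two (l₁ := .y) (l₂ := .z) (v₁ := 0) (v₂ := 1) (by decide)
        (by rintro (_ | _ | _) <;> rfl)]
      omega
  | succ m ih =>
    intro r s ζ ξ η hm hr hs hv
    have l1 := h.le hv
    by_cases hne : r = N ∧ s = N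
    · exact ih r s ζ ξ η (by omega) hr hs hv
    rcases h.next_xz hv hne with ⟨hrN, b, -, hb⟩ | ⟨hsN, b, -, hb⟩
    · obtain ⟨k, hk, hkN, ⟨ζ', hζ'⟩, ⟨η', hη'⟩, hc⟩ := h.block hr hrN hb
      obtain ⟨L, h0, h1, h2⟩ := ih (r + k) s ζ' ξ η' (by omega) hζ' hs hη'
      have d1 := drop_sigRow_one_z k hv hη'
      rcases hc with ⟨ζ'', hc⟩ | ⟨ζ'', hc⟩
      · obtain ⟨e0, e1, e2⟩ := BlockShape.row_three_cd k
        refine ⟨(BlockShape.cd, k) :: L, ?_, ?_, ?_⟩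
        · rw [hcons, e0, h0, drop_sigRow_zero_x k hr hc, drop_sigRow_zero_y k hc hζ',
            List.append_assoc]
        · rw [hcons, e1, h1, d1]
        · rw [hcons, e2, h2, List.nil_append]
      · obtain ⟨e0, e1, e2⟩ := BlockShape.row_three_dc k
        refine ⟨(BlockShape.dc, k) :: L, ?_, ?_, ?_⟩
        · rw [hcons, e0, h0, drop_sigRow_zero_y k hr hc, drop_sigRow_zero_x k hc hζ',
            List.append_assoc]
        · rw [hcons, e1, h1, d1]
        · rw [hcons, e2, h2, List.nil_append]
    · obtain ⟨k, hk, hkN, ⟨ξ', hξ'⟩, ⟨η', hη'⟩, hc⟩ := h.flip.block hs hsN hb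
      obtain ⟨L, h0, h1, h2⟩ := ih r (s + k) ζ ξ' η' (by omega) hr hξ' hη'
      have d1 := drop_sigRow_one_x k hv hη'
      rcases hc with ⟨ζ'', hc⟩ | ⟨ζ'', hc⟩
      · obtain ⟨e0, e1, e2⟩ := BlockShape.row_three_ba k
        refine ⟨(BlockShape.ba, k) :: L, ?_, ?_, ?_⟩
        · rw [hcons, e0, h0, List.nil_append]
        · rw [hcons, e1, h1, d1]
        · rw [hcons, e2, h2, drop_sigRow_two_z k hs hc, drop_sigRow_two_y k hc hξ',
            List.append_assoc]
      · obtain ⟨e0, e1, e2⟩ := BlockShape.row_three_ab k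
        refine ⟨(BlockShape.ab, k) :: L, ?_, ?_, ?_⟩
        · rw [hcons, e0, h0, List.nil_append]
        · rw [hcons, e1, h1, d1]
        · rw [hcons, e2, h2, drop_sigRow_two_y k hs hc, drop_sigRow_two_z k hc hξ',
            List.append_assoc]

/-- The rows determined by the word `σ` form the tableau of a sequence of balanced blocks. -/
theorem exists_blocks {σ : List XYZ} (h : RegularChain N (Visits σ)) :
    ∃ L : List (BlockShape × ℕ), ∀ i, blocksTableau 3 L i = σ.filterMap (sigRow i) := by
  obtain ⟨L, h0, h1, h2⟩ := h.exists_blocks_drop (N + N) 0 0 0 0 0 le_rfl h.zero h.zero h.zero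
  refine ⟨L, ?_⟩
  simp only [add_zero, List.drop_zero] at h0 h1 h2
  intro i
  fin_cases i
  exacts [h0, h1, h2]

/-- A nonempty word that determines a regular chain has the turn factorization. -/
theorem hasTurnFactorization {σ : List XYZ} (h : RegularChain N (Visits σ)) (hσ : σ ≠ []) :
    HasTurnFactorization σ := by
  have hσN : σ.count .x = N ∧ σ.count .y = N ∧ σ.count .z = N := by
    have h1 := h.le (⟨σ, List.prefix_rfl, rfl, rfl, rfl⟩ : Visits σ _ _ _)
    obtain ⟨τ, hτ, e1, e2, e3⟩ := h.top
    have l1 := hτ.count_le XYZ.x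
    have l2 := hτ.count_le XYZ.y
    have l3 := hτ.count_le XYZ.z
    omega
  have hN : N ≠ 0 := by
    rintro rfl
    cases σ with
    | nil => exact hσ rfl
    | cons l σ => cases l <;> simp at hσN
  have split : ∀ {x y z x' y' z' : ℕ}, Visits σ x y z → Visits σ x' y' z' →
      x + y + z ≤ x' + y' + z' →
      ∃ α β γ : List XYZ, σ = α ++ β ++ γ ∧
        (α.count .x = x ∧ α.count .y = y ∧ α.count .z = z) ∧
        (β.count .x = x' - x ∧ β.count .y = y' - y ∧ β.count .z = z' - z) ∧
        (γ.count .x = N - x' ∧ γ.count .y = N - y' ∧ γ.count .z = N - z') := by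
    rintro x y z x' y' z' ⟨τ, hτ, rfl, rfl, rfl⟩ ⟨τ', hτ', rfl, rfl, rfl⟩ hle
    have hlen : ∀ l : List XYZ, l.length = l.count .x + l.count .y + l.count .z := by
      intro l
      induction l with
      | nil => rfl
      | cons a l ih => cases a <;> simp [ih] <;> omega
    obtain ⟨β, rfl⟩ := List.prefix_of_prefix_length_le hτ hτ' (by rw [hlen, hlen]; exact hle)
    obtain ⟨γ, rfl⟩ := hτ'
    refine ⟨τ, β, γ, rfl, ⟨rfl, rfl, rfl⟩, ?_, ?_⟩
    · simp only [List.count_append] at *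
      omega
    · simp only [List.count_append] at *
      omega
  obtain ⟨p, hp, ⟨h1, h2⟩ | ⟨h1, h2⟩⟩ := h.exists_turn
  · obtain ⟨α, β, γ, hs, ⟨a1, a2, a3⟩, ⟨b1, b2, b3⟩, c1, c2, c3⟩ := split h1 h2 (by omega)
    -- Cutting at (p,p,0) and (N,p,p) leaves the required counts with q = N - p.
    refine ⟨α, β, γ, p, N - p, Or.inl hs, by omega, ?_⟩
    rw [letterCounts, a1, a2, a3, b1, b2, b3, c1, c2, c3]
    simp
  · obtain ⟨α, β, γ, hs, ⟨a1, a2, a3⟩, ⟨b1, b2, b3⟩, c1, c2, c3⟩ := split h1 h2 (by omega)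
    -- The cuts at (0,p,p) and (p,p,N) produce the factors in reverse order, with N - p and p as the
    -- two parameters.
    refine ⟨γ, β, α, N - p, p, Or.inr hs, by omega, ?_⟩
    rw [letterCounts, a1, a2, a3, b1, b2, b3, c1, c2, c3]
    simp

end RegularChain

/-! ### Words of crossings that are regular on triples, and their regular chains -/

/-- The letter that records a crossing `p` in the signature of the triple `i < j < k`. -/
def tripleLetter {n : ℕ} (i j k : Fin n) (p : Fin n × Fin n) : Option XYZ :=
  if p = (i, j) then some XYZ.x else if p = (i, k) then some XYZ.y
    else if p = (j, k) then some XYZ.z else none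

/-- All restrictions to triples of the sequence of crossings `w` have the signature `σ`. -/
def IsRegularWord {n : ℕ} (σ : List XYZ) (w : List (Fin n × Fin n)) : Prop :=
  ∀ i j k : Fin n, i < j → j < k → w.filterMap (tripleLetter i j k) = σ

theorem count_filterMap_tripleLetter {n : ℕ} {i j k : Fin n} (hij : i < j) (hjk : j < k)
    (v : List (Fin n × Fin n)) :
    (v.filterMap (tripleLetter i j k)).count XYZ.x = v.count (i, j) ∧
      (v.filterMap (tripleLetter i j k)).count XYZ.y = v.count (i, k) ∧
      (v.filterMap (tripleLetter i j k)).count XYZ.z = v.count (j, k) := by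
  have h1 := hij.ne
  have h2 := hjk.ne
  refine ⟨?_, ?_, ?_⟩ <;>
  · rw [List.count_filterMap, List.count]
    congr 1
    funext p
    rw [Bool.eq_iff_iff, beq_iff_eq, beq_iff_eq, tripleLetter]
    constructor
    · intro h
      split_ifs at h <;> simp_all
    · rintro rfl
      simp [*, h1.symm, h2.symm]

theorem exists_prefix_of_prefix_filterMap {α β : Type*} (f : α → Option β) (w : List α)
    {τ : List β} (h : τ <+: w.filterMap f) : ∃ v, v <+: w ∧ v.filterMap f = τ := by
  obtain ⟨ρ, hρ⟩ := h
  obtain ⟨l₁, l₂, rfl, h1, -⟩ := List.filterMap_eq_append_iff.1 hρ.symm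
  exact ⟨l₁, List.prefix_append _ _, h1⟩

theorem exists_prefix_count_eq {α : Type*} [BEq α] [LawfulBEq α] (a : α) (w : List α) {k : ℕ}
    (hk : k < w.count a) : ∃ v, v ++ [a] <+: w ∧ v.count a = k := by
  induction w generalizing k with
  | nil => simp at hk
  | cons b w ih =>
    rw [List.count_cons] at hk
    rcases eq_or_ne b a with rfl | hb
    · rcases Nat.eq_zero_or_pos k with rfl | h0
      · exact ⟨[], by simp, rfl⟩
      · simp only [beq_self_eq_true, if_true] at hk
        obtain ⟨v, hv, hc⟩ := ih (k := k - 1) (by omega)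
        refine ⟨b :: v, by simpa using hv, ?_⟩
        rw [List.count_cons_self, hc]
        omega
    · obtain ⟨v, hv, hc⟩ := ih (k := k) (by simpa [hb] using hk)
      refine ⟨b :: v, by simpa using hv, ?_⟩
      rw [List.count_cons_of_ne hb, hc]

namespace IsRegularWord

variable {n : ℕ} {σ : List XYZ} {w : List (Fin n × Fin n)}

theorem visits (hw : IsRegularWord σ w) {v : List (Fin n × Fin n)} (hv : v <+: w) {i j k : Fin n}
    (hij : i < j) (hjk : j < k) :
    Visits σ (v.count (i, j)) (v.count (i, k)) (v.count (j, k)) := by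
  obtain ⟨h1, h2, h3⟩ := count_filterMap_tripleLetter hij hjk v
  refine ⟨_, ?_, h1, h2, h3⟩
  rw [← hw i j k hij hjk]
  exact hv.filterMap _

theorem exists_prefix (hw : IsRegularWord σ w) {x y z : ℕ} (h : Visits σ x y z) {i j k : Fin n}
    (hij : i < j) (hjk : j < k) :
    ∃ v, v <+: w ∧ v.count (i, j) = x ∧ v.count (i, k) = y ∧ v.count (j, k) = z := by
  obtain ⟨τ, hτ, rfl, rfl, rfl⟩ := h
  rw [← hw i j k hij hjk] at hτ
  obtain ⟨v, hv, rfl⟩ := exists_prefix_of_prefix_filterMap _ _ hτ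
  obtain ⟨h1, h2, h3⟩ := count_filterMap_tripleLetter hij hjk v
  exact ⟨v, hv, h1.symm, h2.symm, h3.symm⟩

theorem count_eq {w : List (Fin 4 × Fin 4)} (hw : IsRegularWord σ w) (i j : Fin 4) (hij : i < j) :
    w.count (i, j) = σ.count XYZ.x := by
  have key : ∀ i j k : Fin 4, i < j → j < k → w.count (i, j) = σ.count XYZ.x ∧
      w.count (i, k) = σ.count XYZ.y ∧ w.count (j, k) = σ.count XYZ.z := by
    intro i j k hij hjk
    obtain ⟨h1, h2, h3⟩ := count_filterMap_tripleLetter hij hjk w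
    rw [hw i j k hij hjk] at h1 h2 h3
    exact ⟨h1.symm, h2.symm, h3.symm⟩
  have a1 := key 0 1 2 (by decide) (by decide)
  have a2 := key 0 1 3 (by decide) (by decide)
  have a3 := key 0 2 3 (by decide) (by decide)
  have a4 := key 1 2 3 (by decide) (by decide)
  have : (i = 0 ∧ j = 1) ∨ (i = 0 ∧ j = 2) ∨ (i = 0 ∧ j = 3) ∨ (i = 1 ∧ j = 2) ∨
      (i = 1 ∧ j = 3) ∨ (i = 2 ∧ j = 3) := by
    revert i j
    decide
  rcases this with ⟨rfl, rfl⟩ | ⟨rfl, rfl⟩ | ⟨rfl, rfl⟩ | ⟨rfl, rfl⟩ | ⟨rfl, rfl⟩ | ⟨rfl, rfl⟩ <;>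
    omega

theorem regularChain {w : List (Fin 4 × Fin 4)} (hw : IsRegularWord σ w)
    (hirr : IrreducibleWord σ) : RegularChain (σ.count XYZ.x) (Visits σ) := by
  have k012 := fun (v) (hv : v <+: w) =>
    hw.visits hv (show (0 : Fin 4) < 1 by decide) (show (1 : Fin 4) < 2 by decide)
  have k013 := fun (v) (hv : v <+: w) =>
    hw.visits hv (show (0 : Fin 4) < 1 by decide) (show (1 : Fin 4) < 3 by decide)
  have k023 := fun (v) (hv : v <+: w) =>
    hw.visits hv (show (0 : Fin 4) < 2 by decide) (show (2 : Fin 4) < 3 by decide)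
  have k123 := fun (v) (hv : v <+: w) =>
    hw.visits hv (show (1 : Fin 4) < 2 by decide) (show (2 : Fin 4) < 3 by decide)
  have top : Visits σ (σ.count XYZ.x) (σ.count XYZ.x) (σ.count XYZ.x) := by
    have := k012 w List.prefix_rfl
    rwa [hw.count_eq 0 1 (by decide), hw.count_eq 0 2 (by decide),
      hw.count_eq 1 2 (by decide)] at this
  have le : ∀ {x y z}, Visits σ x y z →
      x ≤ σ.count XYZ.x ∧ y ≤ σ.count XYZ.x ∧ z ≤ σ.count XYZ.x := by
    intro x y z hV
    obtain ⟨v, hv, rfl, rfl, rfl⟩ := hw.exists_prefix hV (show (0 : Fin 4) < 1 by decide)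
      (show (1 : Fin 4) < 2 by decide)
    rw [← hw.count_eq 0 1 (by decide)]
    refine ⟨hv.count_le _, ?_, ?_⟩
    · rw [hw.count_eq 0 1 (by decide), ← hw.count_eq 0 2 (by decide)]
      exact hv.count_le _
    · rw [hw.count_eq 0 1 (by decide), ← hw.count_eq 1 2 (by decide)]
      exact hv.count_le _
  refine ⟨⟨[], by simp, rfl, rfl, rfl⟩, top, le, visits_cmp, ?_, ?_, ?_, ?_, ?_, ?_⟩
  · rintro c ⟨τ, hτ, h1, h2, h3⟩
    by_contra hne
    push Not at hne
    refine hirr.2 ⟨τ, hτ, ?_, ?_, h1.trans h2.symm, h2.trans h3.symm⟩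
    · rintro rfl
      exact hne.1 h1.symm
    · rintro rfl
      exact hne.2 h1.symm
  · intro k hk
    obtain ⟨v, hv, rfl⟩ := exists_prefix_count_eq ((0 : Fin 4), (1 : Fin 4)) w (k := k)
      (by rwa [hw.count_eq 0 1 (by decide)])
    have hv' : v <+: w := (List.prefix_append _ _).trans hv
    have a1 := k012 v hv'
    have a2 := k012 _ hv
    have a3 := k013 v hv'
    have a4 := k013 _ hv
    have a5 := k023 v hv'
    have a6 := k123 v hv'
    simp [List.count_append] at a2 a4
    -- Both triples pass from x = k to x = k + 1 here. A chain does this only once, so their other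
    -- two counts agree.
    have c1 := visits_cmp a1 a4
    have c2 := visits_cmp a3 a2
    have e1 : v.count (0, 3) = v.count (0, 2) := by omega
    have e2 : v.count (1, 3) = v.count (1, 2) := by omega
    rw [e1] at a5
    rw [e2] at a6
    exact ⟨_, _, _, a1, a2, a5, a6⟩
  · intro k hk
    obtain ⟨v, hv, rfl⟩ := exists_prefix_count_eq ((0 : Fin 4), (3 : Fin 4)) w (k := k)
      (by rwa [hw.count_eq 0 3 (by decide)])
    have hv' : v <+: w := (List.prefix_append _ _).trans hv
    have a1 := k013 v hv'
    have a2 := k013 _ hv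
    have a3 := k023 v hv'
    have a4 := k023 _ hv
    have a5 := k012 v hv'
    have a6 := k123 v hv'
    simp [List.count_append] at a2 a4
    have c1 := visits_cmp a1 a4
    have c2 := visits_cmp a3 a2
    have e1 : v.count (0, 2) = v.count (0, 1) := by omega
    have e2 : v.count (2, 3) = v.count (1, 3) := by omega
    rw [e1] at a5
    rw [e2] at a6
    exact ⟨_, _, _, a1, a2, a5, a6⟩
  · intro k hk
    obtain ⟨v, hv, rfl⟩ := exists_prefix_count_eq ((2 : Fin 4), (3 : Fin 4)) w (k := k)
      (by rwa [hw.count_eq 2 3 (by decide)])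
    have hv' : v <+: w := (List.prefix_append _ _).trans hv
    have a1 := k023 v hv'
    have a2 := k023 _ hv
    have a3 := k123 v hv'
    have a4 := k123 _ hv
    have a5 := k012 v hv'
    have a6 := k013 v hv'
    simp [List.count_append] at a2 a4
    have c1 := visits_cmp a1 a4
    have c2 := visits_cmp a3 a2
    have e1 : v.count (1, 2) = v.count (0, 2) := by omega
    have e2 : v.count (1, 3) = v.count (0, 3) := by omega
    rw [e1] at a5
    rw [e2] at a6
    exact ⟨_, _, _, a1, a2, a5, a6⟩
  · intro c z hc
    obtain ⟨u, hu, u1, u2, -⟩ := hw.exists_prefix hc (show (0 : Fin 4) < 1 by decide)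
      (show (1 : Fin 4) < 2 by decide)
    obtain ⟨v, hv, v1, v2, -⟩ := hw.exists_prefix hc (show (0 : Fin 4) < 1 by decide)
      (show (1 : Fin 4) < 3 by decide)
    obtain ⟨t, ht, t1, t2, -⟩ := hw.exists_prefix hc (show (0 : Fin 4) < 2 by decide)
      (show (2 : Fin 4) < 3 by decide)
    -- Each of u, v, t attains two of the three counts. The median one in the prefix order attains
    -- the third as well, since the count it lacks equals c at both of the others.
    obtain ⟨s, hs, s1, s2, s3⟩ : ∃ s, s <+: w ∧ s.count (0, 1) = c ∧ s.count (0, 2) = c ∧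
        s.count (0, 3) = c := by
      have mono : ∀ {p q : List (Fin 4 × Fin 4)}, p <+: q → p.count (0, 1) ≤ q.count (0, 1) ∧
          p.count (0, 2) ≤ q.count (0, 2) ∧ p.count (0, 3) ≤ q.count (0, 3) := fun h =>
        ⟨h.count_le _, h.count_le _, h.count_le _⟩
      rcases List.prefix_or_prefix_of_prefix hu hv with h1 | h1 <;>
      rcases List.prefix_or_prefix_of_prefix hu ht with h2 | h2 <;>
      rcases List.prefix_or_prefix_of_prefix hv ht with h3 | h3 <;>
      have m1 := mono h1 <;> have m2 := mono h2 <;> have m3 := mono h3 <;>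
      first
      | exact ⟨u, hu, by omega, by omega, by omega⟩
      | exact ⟨v, hv, by omega, by omega, by omega⟩
      | exact ⟨t, ht, by omega, by omega, by omega⟩
    have b1 := k012 s hs
    have b2 := k013 s hs
    have b3 := k023 s hs
    rw [s1, s2] at b1
    rw [s1, s3] at b2
    rw [s2, s3] at b3
    exact ⟨_, _, _, b1, b2, b3, k123 s hs⟩
  · intro c z hc
    obtain ⟨u, hu, -, u1, u2⟩ := hw.exists_prefix hc (show (0 : Fin 4) < 1 by decide)
      (show (1 : Fin 4) < 3 by decide)
    obtain ⟨v, hv, -, v1, v2⟩ := hw.exists_prefix hc (show (0 : Fin 4) < 2 by decide)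
      (show (2 : Fin 4) < 3 by decide)
    obtain ⟨t, ht, -, t1, t2⟩ := hw.exists_prefix hc (show (1 : Fin 4) < 2 by decide)
      (show (2 : Fin 4) < 3 by decide)
    obtain ⟨s, hs, s1, s2, s3⟩ : ∃ s, s <+: w ∧ s.count (0, 3) = c ∧ s.count (1, 3) = c ∧
        s.count (2, 3) = c := by
      have mono : ∀ {p q : List (Fin 4 × Fin 4)}, p <+: q → p.count (0, 3) ≤ q.count (0, 3) ∧
          p.count (1, 3) ≤ q.count (1, 3) ∧ p.count (2, 3) ≤ q.count (2, 3) := fun h =>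
        ⟨h.count_le _, h.count_le _, h.count_le _⟩
      rcases List.prefix_or_prefix_of_prefix hu hv with h1 | h1 <;>
      rcases List.prefix_or_prefix_of_prefix hu ht with h2 | h2 <;>
      rcases List.prefix_or_prefix_of_prefix hv ht with h3 | h3 <;>
      have m1 := mono h1 <;> have m2 := mono h2 <;> have m3 := mono h3 <;>
      first
      | exact ⟨u, hu, by omega, by omega, by omega⟩
      | exact ⟨v, hv, by omega, by omega, by omega⟩
      | exact ⟨t, ht, by omega, by omega, by omega⟩
    have b1 := k013 s hs
    have b2 := k023 s hs
    have b3 := k123 s hs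
    rw [s1, s2] at b1
    rw [s1, s3] at b2
    rw [s2, s3] at b3
    exact ⟨_, _, _, b1, b2, b3, k012 s hs⟩

end IsRegularWord

/-! ### Restriction of block tableaux and rows to triples -/

/-- The order embedding of `Fin 3` with values `i < j < k`. -/
def tripleEmb {n : ℕ} {i j k : Fin n} (hij : i < j) (hjk : j < k) : Fin 3 ↪o Fin n :=
  OrderEmbedding.ofStrictMono ![i, j, k] (by
    intro a b hab
    fin_cases a <;> fin_cases b <;> simp_all
    exact hij.trans hjk)

section Rows

variable {m n : ℕ}

theorem List.eq_of_strictly_sorted {α : Type*} [LinearOrder α] {l l' : List α}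
    (h : l.Pairwise (· < ·)) (h' : l'.Pairwise (· < ·)) (hm : ∀ a, a ∈ l ↔ a ∈ l') : l = l' :=
  List.Perm.eq_of_pairwise (fun _ _ _ _ h1 h2 => absurd h1 h2.asymm) h h'
    ((List.perm_ext_iff_of_nodup (h.imp fun hab => hab.ne) (h'.imp fun hab => hab.ne)).2 hm)

theorem finRange_filter_filter_range (e : Fin m ↪o Fin n) (P : Fin n → Prop) [DecidablePred P]
    [DecidablePred fun j => j ∈ Set.range e] :
    ((List.finRange n).filter fun j => P j).filter (fun j => j ∈ Set.range e) =
      ((List.finRange m).filter fun j => P (e j)).map e := by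
  apply List.eq_of_strictly_sorted
  · exact ((List.pairwise_lt_finRange n).filter _).filter _
  · exact ((List.pairwise_lt_finRange m).filter _).map _ fun a b hab => e.strictMono hab
  · intro a
    simp only [List.mem_filter, List.mem_finRange, List.mem_map, decide_eq_true_eq, true_and,
      Set.mem_range]
    constructor
    · rintro ⟨h, b, rfl⟩
      exact ⟨b, h, rfl⟩
    · rintro ⟨b, h, rfl⟩
      exact ⟨h, b, rfl⟩

theorem filter_flatMap_replicate {α : Type*} (P : α → Bool) (r : ℕ) (l : List α) :
    (l.flatMap (List.replicate r)).filter P = (l.filter P).flatMap (List.replicate r) := by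
  induction l with
  | nil => rfl
  | cons a l ih =>
    rw [List.flatMap_cons, List.filter_append, ih, List.filter_replicate, List.filter_cons]
    split_ifs <;> simp

theorem map_flatMap_replicate {α β : Type*} (f : α → β) (r : ℕ) (l : List α) :
    (l.flatMap (List.replicate r)).map f = (l.map f).flatMap (List.replicate r) := by
  induction l with
  | nil => rfl
  | cons a l ih => simp [ih]

-- Each block lists the smaller or the larger labels in monotone order with constant multiplicity,
-- and an order embedding respects both.
open Classical in
theorem blocksTableau_filter_range (L : List (BlockShape × ℕ)) (e : Fin m ↪o Fin n) (i : Fin m) :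
    (blocksTableau n L (e i)).filter (fun j => j ∈ Set.range e) =
      (blocksTableau m L i).map e := by
  have key : ∀ (s : BlockShape) (r : ℕ),
      (s.row r n (e i)).filter (fun j => j ∈ Set.range e) = (s.row r m i).map e := by
    intro s r
    cases s
    · simp only [BlockShape.row]
      rw [filter_flatMap_replicate, map_flatMap_replicate, finRange_filter_filter_range]
      simp only [OrderEmbedding.lt_iff_lt]
    · simp only [BlockShape.row]
      rw [filter_flatMap_replicate, map_flatMap_replicate, List.filter_reverse,
        finRange_filter_filter_range, List.map_reverse]
      simp only [OrderEmbedding.lt_iff_lt]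
    · simp only [BlockShape.row]
      rw [filter_flatMap_replicate, map_flatMap_replicate, finRange_filter_filter_range]
      simp only [OrderEmbedding.lt_iff_lt]
    · simp only [BlockShape.row]
      rw [filter_flatMap_replicate, map_flatMap_replicate, List.filter_reverse,
        finRange_filter_filter_range, List.map_reverse]
      simp only [OrderEmbedding.lt_iff_lt]
  simp only [blocksTableau]
  induction L with
  | nil => rfl
  | cons B L ih => rw [List.flatMap_cons, List.flatMap_cons, List.filter_append, List.map_append,
      key, ih]

theorem notMem_blocksTableau (L : List (BlockShape × ℕ)) (i : Fin n) : i ∉ blocksTableau n L i := by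
  intro hi
  obtain ⟨⟨s, r⟩, -, hB⟩ := List.mem_flatMap.1 hi
  cases s <;> simp [BlockShape.row] at hB

end Rows

/-- Record the letters `j` and `k` as `u` and `v`, and forget the others. -/
def pairLetter {n : ℕ} (j k : Fin n) (u v : XYZ) (l : Fin n) : Option XYZ :=
  if l = j then some u else if l = k then some v else none

/-- The rows `ρ` restrict, on every triple, to the rows determined by the signature `σ`. -/
structure RowsOf {n : ℕ} (σ : List XYZ) (ρ : Fin n → List (Fin n)) : Prop where
  notMem : ∀ i, i ∉ ρ i
  fst : ∀ {i j k}, i < j → j < k → (ρ i).filterMap (pairLetter j k .x .y) = σ.filter (· ≠ .z)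
  snd : ∀ {i j k}, i < j → j < k → (ρ j).filterMap (pairLetter i k .x .z) = σ.filter (· ≠ .y)
  trd : ∀ {i j k}, i < j → j < k → (ρ k).filterMap (pairLetter i j .y .z) = σ.filter (· ≠ .x)

theorem RowsOf.reverse {n : ℕ} {σ : List XYZ} {ρ : Fin n → List (Fin n)} (h : RowsOf σ ρ) :
    RowsOf σ.reverse fun i => (ρ i).reverse where
  notMem i := by simpa using h.notMem i
  fst h1 h2 := by rw [List.filterMap_reverse, h.fst h1 h2, List.filter_reverse]
  snd h1 h2 := by rw [List.filterMap_reverse, h.snd h1 h2, List.filter_reverse]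
  trd h1 h2 := by rw [List.filterMap_reverse, h.trd h1 h2, List.filter_reverse]

theorem filterMap_pairLetter_blocksTableau {n : ℕ} (L : List (BlockShape × ℕ)) (e : Fin 3 ↪o Fin n)
    (a b c : Fin 3) (u v : XYZ) :
    (blocksTableau n L (e a)).filterMap (pairLetter (e b) (e c) u v) =
      (blocksTableau 3 L a).filterMap (pairLetter b c u v) := by
  classical
  have h1 : (blocksTableau n L (e a)).filterMap (pairLetter (e b) (e c) u v) =
      ((blocksTableau n L (e a)).filter (fun j => j ∈ Set.range e)).filterMap
        (pairLetter (e b) (e c) u v) := by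
    rw [List.filterMap_filter]
    congr 1
    funext l
    by_cases hl : l ∈ Set.range e
    · simp [hl]
    · have hb : l ≠ e b := by
        rintro rfl
        exact hl ⟨b, rfl⟩
      have hc : l ≠ e c := by
        rintro rfl
        exact hl ⟨c, rfl⟩
      simp [pairLetter, hl, hb, hc]
  rw [h1, blocksTableau_filter_range, List.filterMap_map]
  congr 1
  funext l
  simp [pairLetter]

theorem rowsOf_blocksTableau {σ : List XYZ} {L : List (BlockShape × ℕ)}
    (hL : ∀ i, blocksTableau 3 L i = σ.filterMap (sigRow i)) (n : ℕ) :
    RowsOf σ (blocksTableau n L) := by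
  have key : ∀ (e : Fin 3 ↪o Fin n) (a b c : Fin 3) (u v : XYZ),
      (blocksTableau n L (e a)).filterMap (pairLetter (e b) (e c) u v) =
        σ.filterMap fun l => (sigRow a l).bind (pairLetter b c u v) := by
    intro e a b c u v
    rw [filterMap_pairLetter_blocksTableau, hL, List.filterMap_filterMap]
  have fin : ∀ (a b c : Fin 3) (u v w : XYZ),
      (∀ l, (sigRow a l).bind (pairLetter b c u v) = Option.guard (fun l => l ≠ w) l) →
      (σ.filterMap fun l => (sigRow a l).bind (pairLetter b c u v)) = σ.filter (· ≠ w) := by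
    intro a b c u v w h
    rw [funext h, List.filterMap_eq_filter]
  refine ⟨notMem_blocksTableau L, ?_, ?_, ?_⟩ <;> intro i j k hij hjk
  · exact (key (tripleEmb hij hjk) 0 1 2 .x .y).trans
      (fin _ _ _ _ _ _ (by rintro (_ | _ | _) <;> decide))
  · exact (key (tripleEmb hij hjk) 1 0 2 .x .z).trans
      (fin _ _ _ _ _ _ (by rintro (_ | _ | _) <;> decide))
  · exact (key (tripleEmb hij hjk) 2 0 1 .y .z).trans
      (fin _ _ _ _ _ _ (by rintro (_ | _ | _) <;> decide))

/-! ### Construction of a regular word by trimming the rows -/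

theorem filterMap_erase_none {α β : Type*} [DecidableEq α] {f : α → Option β} {a : α} (h : f a = none) (l : List α) :
    (l.erase a).filterMap f = l.filterMap f := by
  induction l with
  | nil => rfl
  | cons c l ih =>
    rcases eq_or_ne c a with rfl | hc
    · simp [h]
    · rw [List.erase_cons_tail (by simpa using hc), List.filterMap_cons, List.filterMap_cons, ih]

section Trim

variable {α β : Type*} [DecidableEq α] [DecidableEq β] {f : α → Option β}

theorem filterMap_erase_some (hf : ∀ a a' b, f a = some b → f a' = some b → a = a') {a : α} {b : β}
    (h : f a = some b) (l : List α) : (l.erase a).filterMap f = (l.filterMap f).erase b := by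
  induction l with
  | nil => rfl
  | cons c l ih =>
    rcases eq_or_ne c a with rfl | hc
    · simp [h]
    · rw [List.erase_cons_tail (by simpa using hc), List.filterMap_cons, List.filterMap_cons, ih]
      cases hfc : f c with
      | none => rfl
      | some d =>
        have : d ≠ b := by
          rintro rfl
          exact hc (hf _ _ _ hfc h)
        simp [List.erase_cons_tail, this]

/-- Injectivity where `f` is defined makes deleting the first letter over `b` the same as deleting
the first `b`. Thus trimming a row commutes with restricting it to a triple. -/
theorem filterMap_diff (hf : ∀ a a' b, f a = some b → f a' = some b → a = a') (l m : List α) :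
    (l.diff m).filterMap f = (l.filterMap f).diff (m.filterMap f) := by
  induction m generalizing l with
  | nil => simp
  | cons a m ih =>
    rw [List.diff_cons, ih, List.filterMap_cons]
    cases hfa : f a with
    | none => simp [filterMap_erase_none hfa]
    | some b => simp [filterMap_erase_some hf hfa]

theorem append_diff_left (l m : List α) : (l ++ m).diff l = m := by
  induction l with
  | nil => simp
  | cons a l ih => simpa using ih

end Trim

theorem pairLetter_injective {n : ℕ} {j k : Fin n} {u v : XYZ} (huv : u ≠ v) (a a' : Fin n)
    (b : XYZ) (h : pairLetter j k u v a = some b) (h' : pairLetter j k u v a' = some b) :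
    a = a' := by
  unfold pairLetter at h h'
  split_ifs at h h' <;> simp_all

theorem eq_replicate_of_count {α : Type*} [DecidableEq α] {l : List α} {u : α} {n : ℕ}
    (h : ∀ v, v ≠ u → l.count v = 0) (hn : l.count u = n) : l = List.replicate n u := by
  have hmem : ∀ b ∈ l, b = u := by
    intro b hb
    by_contra hne
    exact List.count_eq_zero.1 (h b hne) hb
  have := List.eq_replicate_of_mem hmem
  rw [this, List.count_replicate_self] at hn
  rw [this, hn]

/-- Remove the letters of `F` from the front and the letters of `G` from the back of a list. -/
def trim {α : Type*} [DecidableEq α] (F G l : List α) : List α := ((l.diff F).reverse.diff G).reverse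

theorem trim_append {α : Type*} [DecidableEq α] (F G m : List α) :
    trim F G (F ++ m ++ G.reverse) = m := by
  rw [trim, List.append_assoc, append_diff_left, List.reverse_append, List.reverse_reverse,
    append_diff_left, List.reverse_reverse]

theorem filterMap_trim {α β : Type*} [DecidableEq α] [DecidableEq β] {f : α → Option β}
    (hf : ∀ a a' b, f a = some b → f a' = some b → a = a') (F G l : List α) :
    (trim F G l).filterMap f = trim (F.filterMap f) (G.filterMap f) (l.filterMap f) := by
  rw [trim, List.filterMap_reverse, filterMap_diff hf, List.filterMap_reverse, filterMap_diff hf,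
    trim]

theorem mem_of_mem_trim {α : Type*} [DecidableEq α] {F G l : List α} {a : α}
    (h : a ∈ trim F G l) : a ∈ l := by
  rw [trim, List.mem_reverse] at h
  exact List.diff_subset _ _ (List.mem_reverse.1 (List.diff_subset _ _ h))

/-- The pair of `i` and `j`, smaller element first. -/
def sortedPair {n : ℕ} (i j : Fin n) : Fin n × Fin n := if i < j then (i, j) else (j, i)

theorem sortedPair_lt {n : ℕ} {i j : Fin n} (h : j ≠ i) :
    (sortedPair i j).1 < (sortedPair i j).2 := by
  unfold sortedPair
  split_ifs with h1
  · exact h1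
  · exact lt_of_le_of_ne (not_lt.1 h1) h

/-- On a triple i < j < k the rows are αx^qy^q, x^pβz^q and y^pz^pγ, which trimming reduces to α, β
and γ. Listing the trimmed rows of paths 0, 1, 2, 3 in this order therefore reads αβγ on every
triple. A crossing of i < j is recorded p times in the row of i and q times in the row of j. -/
theorem exists_regularWord_of_turn {σ : List XYZ} {ρ : Fin 4 → List (Fin 4)} (hρ : RowsOf σ ρ)
    {α β γ : List XYZ} {p q : ℕ} (hσ : σ = α ++ β ++ γ)
    (hm : letterCounts α β γ = !![p, p, 0; q, 0, p; 0, q, q]) :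
    ∃ w : List (Fin 4 × Fin 4), IsRegularWord σ w ∧ ∀ e ∈ w, e.1 < e.2 := by
  have m00 : α.count .x = p := congrFun (congrFun hm 0) 0
  have m01 : α.count .y = p := congrFun (congrFun hm 0) 1
  have m02 : α.count .z = 0 := congrFun (congrFun hm 0) 2
  have m10 : β.count .x = q := congrFun (congrFun hm 1) 0
  have m11 : β.count .y = 0 := congrFun (congrFun hm 1) 1
  have m12 : β.count .z = p := congrFun (congrFun hm 1) 2
  have m20 : γ.count .x = 0 := congrFun (congrFun hm 2) 0
  have m21 : γ.count .y = q := congrFun (congrFun hm 2) 1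
  have m22 : γ.count .z = q := congrFun (congrFun hm 2) 2
  have rep : ∀ (l : List XYZ) (u w : XYZ) (k : ℕ), u ≠ w → l.count u = k →
      (∀ v, v ≠ u → v ≠ w → l.count v = 0) →
      l.filter (· ≠ w) = List.replicate k u := by
    intro l u w k huw hu h
    refine eq_replicate_of_count (fun v hv => ?_) ?_
    · by_cases hvw : v = w
      · subst hvw
        rw [List.count_eq_zero]
        simp
      · rw [List.count_filter (by simpa using hvw)]
        exact h v hv hvw
    · rw [List.count_filter (by simpa using huw)]
      exact hu
  have self : ∀ (l : List XYZ) (w : XYZ), l.count w = 0 → l.filter (· ≠ w) = l := by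
    intro l w h
    rw [List.filter_eq_self]
    intro a ha
    have : a ≠ w := by
      rintro rfl
      exact List.count_eq_zero.1 h ha
    simpa using this
  have sz : σ.filter (· ≠ .z) = α ++ List.replicate q .x ++ List.replicate q .y := by
    rw [hσ, List.filter_append, List.filter_append, self α _ m02,
      rep β .x .z q (by decide) m10 (by rintro (_ | _ | _) <;> simp [m11]),
      rep γ .y .z q (by decide) m21 (by rintro (_ | _ | _) <;> simp [m20])]
  have sy : σ.filter (· ≠ .y) = List.replicate p .x ++ β ++ List.replicate q .z := by
    rw [hσ, List.filter_append, List.filter_append, self β _ m11,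
      rep α .x .y p (by decide) m00 (by rintro (_ | _ | _) <;> simp [m02]),
      rep γ .z .y q (by decide) m22 (by rintro (_ | _ | _) <;> simp [m20])]
  have sx : σ.filter (· ≠ .x) = List.replicate p .y ++ List.replicate p .z ++ γ := by
    rw [hσ, List.filter_append, List.filter_append, self γ _ m20,
      rep α .y .x p (by decide) m01 (by rintro (_ | _ | _) <;> simp [m02]),
      rep β .z .x p (by decide) m12 (by rintro (_ | _ | _) <;> simp [m11])]
  -- Row i loses p copies of each smaller label in front and q copies of each larger label at the
  -- back. The shapes `ab` and `dc` make the removed parts read y^pz^p and, backwards, x^qy^q on a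
  -- triple, as `trim_append` requires.
  obtain ⟨τ, hτ⟩ : ∃ τ : Fin 4 → List (Fin 4), ∀ i,
      τ i = trim (blocksTableau 4 [(.ab, p)] i) (blocksTableau 4 [(.dc, q)] i) (ρ i) :=
    ⟨_, fun _ => rfl⟩
  have key : ∀ (e : Fin 3 ↪o Fin 4) (a b c : Fin 3) (u v : XYZ), u ≠ v →
      (τ (e a)).filterMap (pairLetter (e b) (e c) u v) =
        trim ((blocksTableau 3 [(.ab, p)] a).filterMap (pairLetter b c u v))
          ((blocksTableau 3 [(.dc, q)] a).filterMap (pairLetter b c u v))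
          ((ρ (e a)).filterMap (pairLetter (e b) (e c) u v)) := by
    intro e a b c u v huv
    rw [hτ, filterMap_trim (pairLetter_injective huv), filterMap_pairLetter_blocksTableau,
      filterMap_pairLetter_blocksTableau]
  have one : ∀ (s : BlockShape) (r : ℕ) (i : Fin 3), blocksTableau 3 [(s, r)] i = s.row r 3 i := by
    intro s r i
    simp [blocksTableau]
  obtain ⟨ab0, ab1, ab2⟩ := BlockShape.row_three_ab p
  obtain ⟨dc0, dc1, dc2⟩ := BlockShape.row_three_dc q
  have t1 : ∀ i j k : Fin 4, i < j → j < k → (τ i).filterMap (pairLetter j k .x .y) = α := by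
    intro i j k hij hjk
    refine (key (tripleEmb hij hjk) 0 1 2 .x .y (by decide)).trans ?_
    refine (congrArg (trim _ _) ((hρ.fst hij hjk).trans sz)).trans ?_
    rw [one, one, ab0, dc0]
    refine Eq.trans ?_ (trim_append [] (List.replicate q .y ++ List.replicate q .x) α)
    simp [pairLetter]
  have t2 : ∀ i j k : Fin 4, i < j → j < k → (τ j).filterMap (pairLetter i k .x .z) = β := by
    intro i j k hij hjk
    refine (key (tripleEmb hij hjk) 1 0 2 .x .z (by decide)).trans ?_
    refine (congrArg (trim _ _) ((hρ.snd hij hjk).trans sy)).trans ?_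
    rw [one, one, ab1, dc1]
    refine Eq.trans ?_ (trim_append (List.replicate p .x) (List.replicate q .z) β)
    simp [pairLetter]
  have t3 : ∀ i j k : Fin 4, i < j → j < k → (τ k).filterMap (pairLetter i j .y .z) = γ := by
    intro i j k hij hjk
    refine (key (tripleEmb hij hjk) 2 0 1 .y .z (by decide)).trans ?_
    refine (congrArg (trim _ _) ((hρ.trd hij hjk).trans sx)).trans ?_
    rw [one, one, ab2, dc2]
    refine Eq.trans ?_ (trim_append (List.replicate p .y ++ List.replicate p .z) [] γ)
    simp [pairLetter]
  have map : ∀ (i j k l : Fin 4) (f : Fin 4 → Option XYZ),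
      (∀ m, tripleLetter j k l (sortedPair i m) = f m) →
      ((τ i).map (sortedPair i)).filterMap (tripleLetter j k l) = (τ i).filterMap f := by
    intro i j k l f hf
    rw [List.filterMap_map]
    congr 1
    exact funext hf
  have nil : ∀ i : Fin 4, (τ i).filterMap (fun _ => (none : Option XYZ)) = [] := by
    intro i
    simp
  refine ⟨(τ 0).map (sortedPair 0) ++ (τ 1).map (sortedPair 1) ++ (τ 2).map (sortedPair 2) ++
    (τ 3).map (sortedPair 3), ?_, ?_⟩
  · intro i j k hij hjk
    have : (i = 0 ∧ j = 1 ∧ k = 2) ∨ (i = 0 ∧ j = 1 ∧ k = 3) ∨ (i = 0 ∧ j = 2 ∧ k = 3) ∨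
        (i = 1 ∧ j = 2 ∧ k = 3) := by
      revert i j k
      decide
    simp only [List.filterMap_append]
    rcases this with ⟨rfl, rfl, rfl⟩ | ⟨rfl, rfl, rfl⟩ | ⟨rfl, rfl, rfl⟩ | ⟨rfl, rfl, rfl⟩
    · rw [map 0 _ _ _ (pairLetter 1 2 .x .y) (by decide), map 1 _ _ _ (pairLetter 0 2 .x .z)
        (by decide), map 2 _ _ _ (pairLetter 0 1 .y .z) (by decide), map 3 _ _ _ (fun _ => none)
        (by decide), t1 0 1 2 hij hjk, t2 0 1 2 hij hjk, t3 0 1 2 hij hjk, nil, hσ]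
      simp
    · rw [map 0 _ _ _ (pairLetter 1 3 .x .y) (by decide), map 1 _ _ _ (pairLetter 0 3 .x .z)
        (by decide), map 3 _ _ _ (pairLetter 0 1 .y .z) (by decide), map 2 _ _ _ (fun _ => none)
        (by decide), t1 0 1 3 hij hjk, t2 0 1 3 hij hjk, t3 0 1 3 hij hjk, nil, hσ]
      simp
    · rw [map 0 _ _ _ (pairLetter 2 3 .x .y) (by decide), map 2 _ _ _ (pairLetter 0 3 .x .z)
        (by decide), map 3 _ _ _ (pairLetter 0 2 .y .z) (by decide), map 1 _ _ _ (fun _ => none)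
        (by decide), t1 0 2 3 hij hjk, t2 0 2 3 hij hjk, t3 0 2 3 hij hjk, nil, hσ]
      simp
    · rw [map 1 _ _ _ (pairLetter 2 3 .x .y) (by decide), map 2 _ _ _ (pairLetter 1 3 .x .z)
        (by decide), map 3 _ _ _ (pairLetter 1 2 .y .z) (by decide), map 0 _ _ _ (fun _ => none)
        (by decide), t1 1 2 3 hij hjk, t2 1 2 3 hij hjk, t3 1 2 3 hij hjk, nil, hσ]
      simp
  · have hmem : ∀ i, ∀ e ∈ (τ i).map (sortedPair i), e.1 < e.2 := by
      intro i e he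
      obtain ⟨j, hj, rfl⟩ := List.mem_map.1 he
      rw [hτ] at hj
      refine sortedPair_lt ?_
      rintro rfl
      exact hρ.notMem _ (mem_of_mem_trim hj)
    intro e he
    simp only [List.mem_append] at he
    rcases he with ((he | he) | he) | he
    exacts [hmem _ e he, hmem _ e he, hmem _ e he, hmem _ e he]

/-- A sequence of crossings of four paths all of whose triples have the signature `σ`. -/
theorem exists_regularWord {σ : List XYZ} {L : List (BlockShape × ℕ)}
    (hL : ∀ i, blocksTableau 3 L i = σ.filterMap (sigRow i)) (hσ : HasTurnFactorization σ) :
    ∃ w : List (Fin 4 × Fin 4), IsRegularWord σ w ∧ ∀ e ∈ w, e.1 < e.2 := by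
  have hρ := rowsOf_blocksTableau hL 4
  obtain ⟨α, β, γ, p, q, hs | hs, -, hm⟩ := hσ
  · exact exists_regularWord_of_turn hρ hs hm
  -- Reading from right to left turns γβα into the other order of factors and preserves the counts.
  · have hm' : letterCounts α.reverse β.reverse γ.reverse = !![p, p, 0; q, 0, p; 0, q, q] := by
      rw [← hm]
      simp [letterCounts]
    obtain ⟨w, hw, hlt⟩ := exists_regularWord_of_turn hρ.reverse (by simp [hs]) hm'
    refine ⟨w.reverse, fun i j k hij hjk => ?_, fun e he => hlt e (List.mem_reverse.1 he)⟩
    rw [List.filterMap_reverse, hw i j k hij hjk, List.reverse_reverse]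

/-! ### Subsystems, and the tableau of a regular system -/

/-- Serves to replace the crossing times of a subsystem by those of the whole system: the additional
times contribute nothing. -/
theorem flatMap_eq_flatMap_of_subset {α β : Type*} [LinearOrder α] {l l' : List α}
    (h : l.Pairwise (· < ·)) (h' : l'.Pairwise (· < ·)) (hsub : ∀ a ∈ l', a ∈ l) {F : α → List β}
    (hF : ∀ a ∈ l, a ∉ l' → F a = []) : l'.flatMap F = l.flatMap F := by
  have h1 : l' = l.filter (· ∈ l') :=
    List.eq_of_strictly_sorted h' (h.filter _) fun a => by
      simpa using hsub a
  have h2 : ∀ m : List α, (∀ a ∈ m, a ∉ l' → F a = []) →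
      (m.filter (· ∈ l')).flatMap F = m.flatMap F := by
    intro m hm
    induction m with
    | nil => rfl
    | cons a m ih =>
      have ih := ih fun b hb => hm b (List.mem_cons_of_mem _ hb)
      by_cases ha : a ∈ l'
      · simp [ha, ih]
      · rw [List.filter_cons_of_neg (by simpa using ha), ih, List.flatMap_cons,
          hm a List.mem_cons_self ha, List.nil_append]
  rw [← h2 l hF, ← h1]

/-- A list is determined by its restrictions to pairs of letters. -/
theorem List.eq_of_filter_pairs {α : Type*} [DecidableEq α] {P : α → Prop}
    (hP : ∀ a, P a → ∃ b, P b ∧ b ≠ a) {l l' : List α} (hl : ∀ a ∈ l, P a) (hl' : ∀ a ∈ l', P a)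
    (h : ∀ a b, P a → P b → a ≠ b →
      l.filter (fun c => c = a ∨ c = b) = l'.filter (fun c => c = a ∨ c = b)) : l = l' := by
  induction l generalizing l' with
  | nil =>
    cases l' with
    | nil => rfl
    | cons a l' =>
      have ha := hl' a List.mem_cons_self
      obtain ⟨b, hb, hba⟩ := hP a ha
      simpa using h a b ha hb hba.symm
  | cons a l ih =>
    have ha := hl a List.mem_cons_self
    cases l' with
    | nil =>
      obtain ⟨b, hb, hba⟩ := hP a ha
      simpa using h a b ha hb hba.symm
    | cons a' l' =>
      have ha' := hl' a' List.mem_cons_self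
      obtain rfl : a = a' := by
        by_contra hne
        have := h a a' ha ha' hne
        simp [hne] at this
      congr 1
      refine ih (fun b hb => hl b (List.mem_cons_of_mem _ hb))
        (fun b hb => hl' b (List.mem_cons_of_mem _ hb)) fun b c hb hc hbc => ?_
      have := h b c hb hc hbc
      rw [List.filter_cons, List.filter_cons] at this
      split_ifs at this
      · exact (List.cons.inj this).2
      · exact this

namespace PathSystem

variable {n : ℕ}

theorem mem_sortedTimes (S : PathSystem n) (t : unitInterval) :
    t ∈ S.sortedTimes ↔ ∃ i j, i ≠ j ∧ S.path i t = S.path j t := by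
  rw [sortedTimes, Finset.mem_sort, Set.Finite.mem_toFinset]
  rfl

theorem pairwise_sortedTimes (S : PathSystem n) : S.sortedTimes.Pairwise (· < ·) :=
  (Finset.sortedLT_sort _).pairwise

theorem flatMap_sortedTimes_restrict {β : Type*} {m : ℕ} (S : PathSystem n) (hm : 3 ≤ m)
    (e : Fin m ↪o Fin n) {F : unitInterval → List β}
    (hF : ∀ t, (∀ i j, i ≠ j → S.path (e i) t ≠ S.path (e j) t) → F t = []) :
    (S.restrict hm e).sortedTimes.flatMap F = S.sortedTimes.flatMap F := by
  refine flatMap_eq_flatMap_of_subset S.pairwise_sortedTimes (pairwise_sortedTimes _) ?_ ?_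
  · intro t ht
    rw [mem_sortedTimes] at ht ⊢
    obtain ⟨i, j, hij, h⟩ := ht
    exact ⟨e i, e j, e.injective.ne hij, h⟩
  · intro t _ ht
    rw [mem_sortedTimes] at ht
    push Not at ht
    exact hF t fun i j hij => ht i j hij

open Classical in
theorem map_localSequence_restrict {m : ℕ} (S : PathSystem n) (hm : 3 ≤ m) (e : Fin m ↪o Fin n)
    (i : Fin m) : ((S.restrict hm e).localSequence i).map e =
      (S.localSequence (e i)).filter (fun j => j ∈ Set.range e) := by
  have h : ∀ t, ((List.finRange m).filter
      fun j => j ≠ i ∧ (S.restrict hm e).path i t = (S.restrict hm e).path j t).map e =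
      ((List.finRange n).filter fun j => j ≠ e i ∧ S.path (e i) t = S.path j t).filter
        (fun j => j ∈ Set.range e) := by
    intro t
    rw [finRange_filter_filter_range]
    simp only [ne_eq, EmbeddingLike.apply_eq_iff_eq]
    rfl
  rw [localSequence, localSequence, List.map_flatMap, List.filter_flatMap]
  simp only [h]
  refine flatMap_sortedTimes_restrict S hm e fun t ht => ?_
  rw [← h]
  simp only [List.map_eq_nil_iff, List.filter_eq_nil_iff]
  intro j _
  simp only [decide_eq_true_eq, not_and]
  exact fun hji => ht i j (Ne.symm hji)

open Classical in
theorem signature_restrict (S : PathSystem n) (e : Fin 3 ↪o Fin n) :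
    (S.restrict le_rfl e).signature = S.sortedTimes.flatMap fun t =>
      (if S.path (e 0) t = S.path (e 1) t then [XYZ.x] else []) ++
      (if S.path (e 0) t = S.path (e 2) t then [XYZ.y] else []) ++
        (if S.path (e 1) t = S.path (e 2) t then [XYZ.z] else []) := by
  refine flatMap_sortedTimes_restrict S le_rfl e fun t ht => ?_
  simp [restrict, ht 0 1 (by decide), ht 0 2 (by decide), ht 1 2 (by decide)]

/-- The rows of the tableau of a system of size 3 in terms of its signature. -/
theorem tableau_three (S : PathSystem 3) (i : Fin 3) :
    S.tableau i = S.signature.filterMap (sigRow i) := by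
  classical
  rw [tableau, localSequence, signature, List.filterMap_flatMap]
  congr 1
  funext t
  have h1 : ¬ (S.path 0 t = S.path 1 t ∧ S.path 0 t = S.path 2 t) :=
    S.no_triple 0 1 2 (by decide) (by decide) (by decide) t
  have hf : List.finRange 3 = [0, 1, 2] := rfl
  rw [hf]
  by_cases h01 : S.path 0 t = S.path 1 t
  · have h02 : S.path 0 t ≠ S.path 2 t := fun h => h1 ⟨h01, h⟩
    have h12 : S.path 1 t ≠ S.path 2 t := fun h => h02 (h01.trans h)
    fin_cases i <;> simp [h01, h12, h12.symm, sigRow]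
  · by_cases h02 : S.path 0 t = S.path 2 t
    · have h12 : S.path 1 t ≠ S.path 2 t := fun h => h01 (h02.trans h.symm)
      fin_cases i <;> simp [h02, h12, h12.symm, sigRow]
    · by_cases h12 : S.path 1 t = S.path 2 t
      · fin_cases i <;> simp [h02, Ne.symm h02, h12, sigRow]
      · fin_cases i <;> simp [h01, Ne.symm h01, h02, Ne.symm h02, h12, Ne.symm h12]

open Classical in
/-- The sequence of the crossings of a system of size 4. -/
noncomputable def crossingWord (S : PathSystem 4) : List (Fin 4 × Fin 4) :=
  S.sortedTimes.flatMap fun t => [((0 : Fin 4), (1 : Fin 4)), (0, 2), (0, 3), (1, 2), (1, 3),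
    (2, 3)].filter fun e => S.path e.1 t = S.path e.2 t

theorem isRegularWord_crossingWord (S : PathSystem 4) {σ : List XYZ}
    (hS : S.IsRegularWithSignature σ) : IsRegularWord σ S.crossingWord := by
  classical
  intro i j k hij hjk
  rw [← hS.2 (tripleEmb hij hjk), signature_restrict, crossingWord, List.filterMap_flatMap]
  congr 1
  funext t
  have : (i = 0 ∧ j = 1 ∧ k = 2) ∨ (i = 0 ∧ j = 1 ∧ k = 3) ∨ (i = 0 ∧ j = 2 ∧ k = 3) ∨
      (i = 1 ∧ j = 2 ∧ k = 3) := by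
    clear S σ hS t
    revert i j k
    decide
  change _ = (if S.path i t = S.path j t then [XYZ.x] else []) ++
      (if S.path i t = S.path k t then [XYZ.y] else []) ++
        (if S.path j t = S.path k t then [XYZ.z] else [])
  rw [List.filterMap_filter]
  rcases this with ⟨rfl, rfl, rfl⟩ | ⟨rfl, rfl, rfl⟩ | ⟨rfl, rfl, rfl⟩ | ⟨rfl, rfl, rfl⟩ <;>
  · simp only [List.filterMap_cons, List.filterMap_nil, tripleLetter, decide_eq_true_eq]
    simp
    split_ifs <;> simp

/-- The tableau of a regular system is determined by a tableau of blocks for its triples. -/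
theorem tableau_eq_blocksTableau (S : PathSystem n) {σ : List XYZ}
    (hS : S.IsRegularWithSignature σ) {L : List (BlockShape × ℕ)}
    (hL : ∀ i, blocksTableau 3 L i = σ.filterMap (sigRow i)) :
    S.tableau = blocksTableau n L := by
  classical
  have hn := hS.1.1
  have key : ∀ (e : Fin 3 ↪o Fin n) (a : Fin 3),
      (S.tableau (e a)).filter (fun j => j ∈ Set.range e) =
        (blocksTableau n L (e a)).filter (fun j => j ∈ Set.range e) := by
    intro e a
    rw [blocksTableau_filter_range, hL, ← hS.2 e, ← tableau_three]
    exact (map_localSequence_restrict S le_rfl e a).symm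
  have hmem : ∀ i, i ∉ S.tableau i := by
    intro i hi
    obtain ⟨t, -, ht⟩ := List.mem_flatMap.1 hi
    simp at ht
  funext i
  -- Two labels other than `i` form a triple with `i`, and on triples the two tableaux agree.
  refine List.eq_of_filter_pairs (P := fun j => j ≠ i) ?_ ?_ ?_ ?_
  · intro a ha
    have : ({i, a} : Finset (Fin n)).card < Fintype.card (Fin n) := by
      rw [Fintype.card_fin]
      exact Finset.card_le_two.trans_lt (by omega)
    obtain ⟨b, hb⟩ := Finset.exists_mem_notMem_of_card_lt_card
      (s := {i, a}) (t := Finset.univ) (by simpa using this)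
    simp only [Finset.mem_univ, true_and, Finset.mem_insert, Finset.mem_singleton, not_or] at hb
    exact ⟨b, hb⟩
  · rintro a ha rfl
    exact hmem _ ha
  · rintro a ha rfl
    exact notMem_blocksTableau L _ ha
  · intro a b ha hb hab
    obtain ⟨e, he⟩ : ∃ e : Fin 3 ↪o Fin n, Set.range e = {i, a, b} := by
      have hc : ({i, a, b} : Finset (Fin n)).card = 3 := by
        rw [Finset.card_eq_three]
        exact ⟨i, a, b, ha.symm, hb.symm, hab, rfl⟩
      exact ⟨Finset.orderEmbOfFin _ hc, by simp⟩
    obtain ⟨c, hc⟩ : i ∈ Set.range e := by simp [he]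
    have := key e c
    rw [hc] at this
    have hfil : ∀ l : List (Fin n), i ∉ l →
        l.filter (fun j => j = a ∨ j = b) = l.filter (fun j => j ∈ Set.range e) := by
      intro l hl
      refine List.filter_congr fun j hj => ?_
      have hji : j ≠ i := by
        rintro rfl
        exact hl hj
      simp [he, hji]
    rw [hfil _ (hmem i), hfil _ (notMem_blocksTableau L i), this]

end PathSystem

/-! ### Parity of crossings and consistency of signatures -/

theorem lt_iff_lt_of_forall_ne {f g : C(unitInterval, ℝ)} {a b : unitInterval} (hab : a ≤ b)
    (h : ∀ s ∈ Set.Icc a b, f s ≠ g s) : f a < g a ↔ f b < g b := by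
  have ha := h a ⟨le_rfl, hab⟩
  have hb := h b ⟨hab, le_rfl⟩
  constructor
  · intro h1
    by_contra h2
    obtain ⟨s, hs, hfg⟩ := isPreconnected_Icc.intermediate_value₂ (Set.left_mem_Icc.2 hab)
      (Set.right_mem_Icc.2 hab) f.continuous.continuousOn g.continuous.continuousOn h1.le
      (not_lt.1 h2)
    exact h s hs hfg
  · intro h1
    by_contra h2
    obtain ⟨s, hs, hfg⟩ := isPreconnected_Icc.intermediate_value₂ (Set.right_mem_Icc.2 hab)
      (Set.left_mem_Icc.2 hab) f.continuous.continuousOn g.continuous.continuousOn h1.le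
      (not_lt.1 h2)
    exact h s hs hfg

/-- Two paths that cross at each common point have their initial order at `t` if and only if they
meet an even number of times before `t`. -/
theorem lt_iff_even_card {f g : C(unitInterval, ℝ)} (h0 : f 0 < g 0) (E : Finset unitInterval)
    (hE : ∀ t, t ∈ E ↔ f t = g t) (hc : ∀ t ∈ E, CrossAt f g t) (t : unitInterval) (ht : t ∉ E) :
    f t < g t ↔ Even (E.filter (· < t)).card := by
  induction hk : (E.filter (· < t)).card generalizing t with
  | zero =>
    rw [Finset.card_eq_zero, Finset.filter_eq_empty_iff] at hk
    simp only [Even.zero, iff_true]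
    refine (lt_iff_lt_of_forall_ne zero_le fun s hs hfg => ?_).1 h0
    have hsE := (hE s).2 hfg
    have : s = t := le_antisymm hs.2 (not_lt.1 (hk hsE))
    exact ht (this ▸ hsE)
  | succ k ih =>
    have hne : (E.filter (· < t)).Nonempty := Finset.card_pos.1 (by omega)
    -- With s the last meeting before t, the order changes between a point p shortly before s and a
    -- point q shortly after it. The induction hypothesis applies at p, and no meeting separates q
    -- from t.
    obtain ⟨s, hs, hmax⟩ := (E.filter (· < t)).exists_max_image id hne
    rw [Finset.mem_filter] at hs
    obtain ⟨hsE, hst⟩ := hs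
    have hmax : ∀ u ∈ E, u < t → u ≤ s := fun u hu hut =>
      hmax u (Finset.mem_filter.2 ⟨hu, hut⟩)
    have hs0 : 0 < s := by
      refine lt_of_le_of_ne zero_le ?_
      rintro rfl
      exact h0.ne ((hE _).1 hsE)
    obtain ⟨l, u, hl, hu, hlu⟩ : ∃ l u, l < s ∧ s < u ∧ ∀ p ∈ Set.Ioo l s, ∀ q ∈ Set.Ioo s u,
        f p ≠ g p ∧ (f q < g q ↔ ¬ f p < g p) := by
      rcases hc s hsE with ⟨h1, h2⟩ | ⟨h1, h2⟩ <;>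
      · obtain ⟨l, hl, hl'⟩ := (mem_nhdsLT_iff_exists_Ioo_subset' hs0).1 h1
        obtain ⟨u, hu, hu'⟩ := (mem_nhdsGT_iff_exists_Ioo_subset' hst).1 h2
        refine ⟨l, u, hl, hu, fun p hp q hq => ?_⟩
        have a1 := hl' hp
        have a2 := hu' hq
        simp only [Set.mem_ofPred_eq] at a1 a2
        first
        | exact ⟨a1.ne, by simp [a1, a2.le]⟩
        | exact ⟨a1.ne', by simp [a1.le, a2]⟩
    obtain ⟨p, hp⟩ := exists_between hl
    obtain ⟨q, hq⟩ := exists_between (lt_min hu hst)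
    obtain ⟨hne, hpq⟩ := hlu p hp q ⟨hq.1, hq.2.trans_le (min_le_left _ _)⟩
    have hqt := hq.2.trans_le (min_le_right _ _)
    have hcard : (E.filter (· < t)).card = (E.filter (· < p)).card + 1 := by
      rw [← Finset.card_insert_of_notMem (a := s) (s := E.filter (· < p))
        (by simp [hp.2.le])]
      congr 1
      ext v
      simp only [Finset.mem_filter, Finset.mem_insert]
      constructor
      · rintro ⟨hvE, hvt⟩
        by_cases hvs : v = s
        · exact Or.inl hvs
        · refine Or.inr ⟨hvE, ?_⟩
          by_contra hvp
          have hvs' := lt_of_le_of_ne (hmax v hvE hvt) hvs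
          rcases (not_lt.1 hvp).lt_or_eq with hvp | rfl
          · exact (hlu v ⟨hp.1.trans hvp, hvs'⟩ q
              ⟨hq.1, hq.2.trans_le (min_le_left _ _)⟩).1 ((hE v).1 hvE)
          · exact hne ((hE _).1 hvE)
      · rintro (rfl | ⟨hvE, hvp⟩)
        · exact ⟨hsE, hst⟩
        · exact ⟨hvE, hvp.trans (hp.2.trans hst)⟩
    have hp' := ih p (fun h => hne ((hE p).1 h)) (by omega)
    rw [← lt_iff_lt_of_forall_ne hqt.le, hpq, hp', Nat.even_add_one]
    intro v hv hfg
    have hvE := (hE v).2 hfg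
    rcases hv.2.lt_or_eq with hvt | rfl
    · exact absurd (hmax v hvE hvt) (not_le.2 (hq.1.trans_le hv.1))
    · exact ht hvE

theorem exists_prefix_of_prefix_flatMap {α β : Type*} {F : α → List β} {l : List α}
    (hF : ∀ a ∈ l, (F a).length = 1) {τ : List β} (h : τ <+: l.flatMap F) :
    ∃ l', l' <+: l ∧ τ = l'.flatMap F := by
  induction l generalizing τ with
  | nil => exact ⟨[], List.prefix_rfl, by simpa using h⟩
  | cons a l ih =>
    cases τ with
    | nil => exact ⟨[], by simp, rfl⟩
    | cons b τ =>
      obtain ⟨c, hc⟩ := List.length_eq_one_iff.1 (hF a List.mem_cons_self)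
      rw [List.flatMap_cons, hc, List.singleton_append, List.cons_prefix_cons] at h
      obtain ⟨l', hl', rfl⟩ := ih (fun a ha => hF a (List.mem_cons_of_mem _ ha)) h.2
      exact ⟨a :: l', by simpa using hl', by simp [hc, h.1]⟩

theorem count_flatMap_xyz {α : Type*} (p q r : α → Prop) [DecidablePred p] [DecidablePred q]
    [DecidablePred r] (l : List α) :
    let w := l.flatMap fun a => (if p a then [XYZ.x] else []) ++ (if q a then [XYZ.y] else []) ++
      (if r a then [XYZ.z] else [])
    w.count .x = l.countP p ∧ w.count .y = l.countP q ∧ w.count .z = l.countP r := by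
  induction l with
  | nil => exact ⟨rfl, rfl, rfl⟩
  | cons a l ih =>
    simp only at ih ⊢
    simp only [List.flatMap_cons, List.count_append, ih, List.countP_cons, decide_eq_true_eq]
    by_cases hp : p a <;> by_cases hq : q a <;> by_cases hr : r a <;>
      simp [hp, hq, hr, Nat.add_comm]

/-- The order of three paths is transitive after each initial substring of their signature. -/
def IsConsistent (σ : List XYZ) : Prop :=
  ∀ x y z, Visits σ x y z → (Even x → Even z → Even y) ∧ (¬ Even x → ¬ Even z → ¬ Even y)

namespace PathSystem

/-- Distinct endpoints keep all crossing times strictly between 0 and 1, so there is room for a cut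
before the first and after the last of them. -/
theorem exists_time_of_prefix {n : ℕ} (S : PathSystem n) {l : List unitInterval}
    (h : l <+: S.sortedTimes) : ∃ t, t ∉ S.sortedTimes ∧ l = S.sortedTimes.filter (· < t) := by
  have hn := S.three_le
  have h01 : ∀ t ∈ S.sortedTimes, 0 < t ∧ t < 1 := by
    intro t ht
    obtain ⟨i, j, hij, hm⟩ := (S.mem_sortedTimes t).1 ht
    constructor
    · refine lt_of_le_of_ne zero_le ?_
      rintro rfl
      exact hij (S.left_strictMono.injective hm)
    · refine lt_of_le_of_ne unitInterval.le_one' ?_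
      rintro rfl
      exact hij (S.right_injective hm)
  have hp := S.pairwise_sortedTimes
  obtain ⟨l', hl'⟩ := h
  rw [← hl'] at hp h01 ⊢
  obtain ⟨-, -, hlt⟩ := List.pairwise_append.1 hp
  have key : ∀ b : unitInterval, 0 < b → (∀ a ∈ l, a < b) → ∃ t < b, ∀ a ∈ l, a < t := by
    intro b hb
    clear hl' hp h01 hlt
    induction l with
    | nil => exact fun _ => ⟨0, hb, by simp⟩
    | cons c l ih =>
      intro hc
      obtain ⟨t, ht, h1⟩ := ih fun a ha => hc a (List.mem_cons_of_mem _ ha)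
      obtain ⟨u, hu, hub⟩ := exists_between (hc c List.mem_cons_self)
      refine ⟨max t u, max_lt ht hub, fun a ha => ?_⟩
      rcases List.mem_cons.1 ha with rfl | ha
      · exact hu.trans_le (le_max_right _ _)
      · exact (h1 a ha).trans_le (le_max_left _ _)
  obtain ⟨t, h1, h2⟩ : ∃ t, (∀ a ∈ l, a < t) ∧ ∀ a ∈ l', t < a := by
    cases l' with
    | nil => exact ⟨1, fun a ha => (h01 a (List.mem_append_left _ ha)).2, by simp⟩
    | cons b l' =>
      obtain ⟨t, ht, h1⟩ := key b (h01 b (by simp)).1 fun a ha => hlt a ha b List.mem_cons_self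
      refine ⟨t, h1, fun a ha => ?_⟩
      rcases List.mem_cons.1 ha with rfl | ha
      · exact ht
      · exact ht.trans ((List.pairwise_cons.1 (List.pairwise_append.1 hp).2.1).1 a ha)
  refine ⟨t, ?_, ?_⟩
  · intro ht
    rcases List.mem_append.1 ht with ht | ht
    · exact (h1 t ht).false
    · exact (h2 t ht).false
  · rw [List.filter_append, List.filter_eq_self.2 fun a ha => by simpa using h1 a ha,
      List.filter_eq_nil_iff.2 fun a ha => by simpa using (h2 a ha).le, List.append_nil]

theorem lt_iff_even_countP {n : ℕ} (S : PathSystem n) {i j : Fin n} (hij : i < j)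
    [DecidablePred fun s => S.path i s = S.path j s] {t : unitInterval}
    (ht : t ∉ S.sortedTimes) : S.path i t < S.path j t ↔
      Even ((S.sortedTimes.filter (· < t)).countP fun s => S.path i s = S.path j s) := by
  have hE : ∀ s, s ∈ (S.finite_inter i j hij.ne).toFinset ↔ S.path i s = S.path j s := by
    simp
  have ht' : t ∉ (S.finite_inter i j hij.ne).toFinset := by
    rw [hE]
    exact fun h => ht ((S.mem_sortedTimes t).2 ⟨i, j, hij.ne, h⟩)
  rw [lt_iff_even_card (S.left_strictMono hij) _ hE
    (fun s hs => S.crossAt i j hij.ne s ((hE s).1 hs)) t ht']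
  have hnd : ((S.sortedTimes.filter (· < t)).filter fun s => S.path i s = S.path j s).Nodup :=
    ((S.pairwise_sortedTimes.imp fun h => h.ne).filter _).filter _
  rw [List.countP_eq_length_filter, ← List.toFinset_card_of_nodup hnd]
  congr! 2
  ext s
  simp only [Finset.mem_filter, hE, List.mem_toFinset, List.mem_filter, decide_eq_true_eq,
    mem_sortedTimes]
  exact ⟨fun h => ⟨⟨⟨i, j, hij.ne, h.1⟩, h.2⟩, h.1⟩, fun h => ⟨h.2, h.1.2⟩⟩

/-- A prefix corresponds to a time without crossings. There the parities of the counts give the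
order of the three values, and the order of ℝ is transitive. -/
theorem isConsistent_signature (S : PathSystem 3) : IsConsistent S.signature := by
  classical
  rintro x y z ⟨τ, hτ, rfl, rfl, rfl⟩
  rw [signature] at hτ
  have three : ∀ i : Fin 3, i = 0 ∨ i = 1 ∨ i = 2 := by decide
  have hlen : ∀ t ∈ S.sortedTimes, ((if S.path 0 t = S.path 1 t then [XYZ.x] else []) ++
      (if S.path 0 t = S.path 2 t then [XYZ.y] else []) ++
        (if S.path 1 t = S.path 2 t then [XYZ.z] else [])).length = 1 := by
    intro t ht
    obtain ⟨i, j, hij, hm⟩ := (S.mem_sortedTimes t).1 ht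
    have h1 : ¬ (S.path 0 t = S.path 1 t ∧ S.path 0 t = S.path 2 t) :=
      S.no_triple 0 1 2 (by decide) (by decide) (by decide) t
    have hor : S.path 0 t = S.path 1 t ∨ S.path 0 t = S.path 2 t ∨ S.path 1 t = S.path 2 t := by
      rcases three i with rfl | rfl | rfl <;> rcases three j with rfl | rfl | rfl <;> simp_all
    by_cases h01 : S.path 0 t = S.path 1 t
    · have h02 : S.path 0 t ≠ S.path 2 t := fun h => h1 ⟨h01, h⟩
      have h12 : S.path 1 t ≠ S.path 2 t := fun h => h02 (h01.trans h)
      simp [h01, h12]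
    · by_cases h02 : S.path 0 t = S.path 2 t
      · have h12 : S.path 1 t ≠ S.path 2 t := fun h => h01 (h02.trans h.symm)
        simp [h02, h12, h12.symm]
      · have h12 : S.path 1 t = S.path 2 t := by tauto
        simp [h02, h12]
  obtain ⟨l, hl, rfl⟩ := exists_prefix_of_prefix_flatMap hlen hτ
  obtain ⟨t, ht, hl'⟩ := S.exists_time_of_prefix hl
  obtain ⟨c1, c2, c3⟩ := count_flatMap_xyz (fun s => S.path 0 s = S.path 1 s)
    (fun s => S.path 0 s = S.path 2 s) (fun s => S.path 1 s = S.path 2 s) l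
  have k1 := S.lt_iff_even_countP (i := 0) (j := 1) (by decide) ht
  have k2 := S.lt_iff_even_countP (i := 0) (j := 2) (by decide) ht
  have k3 := S.lt_iff_even_countP (i := 1) (j := 2) (by decide) ht
  rw [← hl'] at k1 k2 k3
  rw [c1, c2, c3, ← k1, ← k2, ← k3]
  have hne : ∀ i j : Fin 3, i ≠ j → S.path i t ≠ S.path j t := fun i j hij h =>
    ht ((S.mem_sortedTimes t).2 ⟨i, j, hij, h⟩)
  refine ⟨fun h1 h2 => h1.trans h2, fun h1 h2 h3 => ?_⟩
  exact absurd (h3.trans_le (not_lt.1 h2 |>.trans (not_lt.1 h1))) (lt_irrefl _)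

end PathSystem

/-! ### Realization of a consistent word of crossings by polygonal paths -/

section Interpolation

/-- The piecewise linear function on `[0, m]` with the value `h k` at the integer `k`. -/
noncomputable def interpolate (h : ℕ → ℝ) (m : ℕ) (s : ℝ) : ℝ :=
  h 0 + ∑ l ∈ Finset.range m, (h (l + 1) - h l) * max 0 (min 1 (s - l))

theorem continuous_interpolate (h : ℕ → ℝ) (m : ℕ) : Continuous (interpolate h m) := by
  unfold interpolate
  fun_prop

theorem interpolate_eq (h : ℕ → ℝ) {m k : ℕ} (hk : k < m) {u : ℝ} (h0 : 0 ≤ u) (h1 : u ≤ 1) :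
    interpolate h m (k + u) = h k + u * (h (k + 1) - h k) := by
  induction m, Nat.succ_le_of_lt hk using Nat.le_induction with
  | base =>
    rw [interpolate, Finset.sum_range_succ]
    have hsum : ∀ l ∈ Finset.range k,
        (h (l + 1) - h l) * max 0 (min 1 ((k : ℝ) + u - l)) = h (l + 1) - h l := by
      intro l hl
      have : (l : ℝ) + 1 ≤ k := by exact_mod_cast Finset.mem_range.1 hl
      rw [min_eq_left (by linarith), max_eq_right zero_le_one, mul_one]
    rw [Finset.sum_congr rfl hsum, Finset.sum_range_sub, add_sub_cancel_left, min_eq_right h1,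
      max_eq_right h0]
    ring
  | succ m hm ih =>
    have hkm : (k : ℝ) + 1 ≤ m := by exact_mod_cast hm
    have := ih hm
    rw [interpolate] at this ⊢
    rw [Finset.sum_range_succ, ← add_assoc, this, max_eq_left, mul_zero, add_zero]
    exact (min_le_right _ _).trans (by linarith)

theorem exists_linear_crossing {x₀ y₀ x₁ y₁ : ℝ} (h₀ : x₀ < y₀) (h₁ : y₁ < x₁) :
    ∃ θ, 0 < θ ∧ θ < 1 ∧ ∀ u,
      (x₀ + u * (x₁ - x₀) = y₀ + u * (y₁ - y₀) ↔ u = θ) ∧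
      (u < θ → x₀ + u * (x₁ - x₀) < y₀ + u * (y₁ - y₀)) ∧
      (θ < u → y₀ + u * (y₁ - y₀) < x₀ + u * (x₁ - x₀)) := by
  have hA : 0 < y₀ - x₀ := by linarith
  have hAB : 0 < (y₀ - x₀) + (x₁ - y₁) := by linarith
  obtain ⟨θ, hθ⟩ : ∃ θ, θ * ((y₀ - x₀) + (x₁ - y₁)) = y₀ - x₀ :=
    ⟨(y₀ - x₀) / ((y₀ - x₀) + (x₁ - y₁)), div_mul_cancel₀ _ hAB.ne'⟩
  refine ⟨θ, ?_, ?_, fun u => ⟨⟨fun h => ?_, ?_⟩, fun h => ?_, fun h => ?_⟩⟩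
  · by_contra hle
    nlinarith [mul_nonneg (sub_nonneg.2 (not_lt.1 hle)) hAB.le]
  · by_contra hle
    nlinarith [mul_nonneg (sub_nonneg.2 (not_lt.1 hle)) hAB.le]
  · refine mul_right_cancel₀ hAB.ne' ?_
    linarith
  · rintro rfl
    linarith
  · nlinarith [mul_pos (sub_pos.2 h) hAB]
  · nlinarith [mul_pos (sub_pos.2 h) hAB]

theorem linear_lt {x₀ y₀ x₁ y₁ u : ℝ} (h₀ : x₀ < y₀) (h₁ : x₁ < y₁) (hu : 0 ≤ u) (hu' : u ≤ 1) :
    x₀ + u * (x₁ - x₀) < y₀ + u * (y₁ - y₀) := by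
  rcases hu'.lt_or_eq with h | rfl
  · nlinarith [mul_pos (sub_pos.2 h) (sub_pos.2 h₀), mul_nonneg hu (sub_nonneg.2 h₁.le)]
  · linarith

end Interpolation

theorem CrossAt.symm {f g : unitInterval → ℝ} {t : unitInterval} (h : CrossAt f g t) :
    CrossAt g f t := Or.symm h

section Realization

variable {n : ℕ}

/-- Path `i` is below path `j` after the first `k` crossings of `w`. -/
def BelowAfter (w : List (Fin n × Fin n)) (k : ℕ) (i j : Fin n) : Prop :=
  (i < j ∧ Even ((w.take k).count (i, j))) ∨ (j < i ∧ ¬ Even ((w.take k).count (j, i)))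

open Classical in
/-- The number of paths below path `i` after the first `k` crossings of `w`. -/
noncomputable def heightAfter (w : List (Fin n × Fin n)) (k : ℕ) (i : Fin n) : ℕ :=
  (Finset.univ.filter fun j => BelowAfter w k j i).card

theorem not_belowAfter_self (w : List (Fin n × Fin n)) (k : ℕ) (i : Fin n) :
    ¬ BelowAfter w k i i := by
  simp [BelowAfter]

theorem belowAfter_or {w : List (Fin n × Fin n)} {k : ℕ} {i j : Fin n} (hij : i ≠ j) :
    BelowAfter w k i j ∨ BelowAfter w k j i := by
  unfold BelowAfter
  rcases lt_or_gt_of_ne hij with h | h <;> simp only [h, h.asymm] <;> tauto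

theorem belowAfter_succ_of_ne {w : List (Fin n × Fin n)} {k : ℕ} {e : Fin n × Fin n}
    (he : w[k]? = some e) {i j : Fin n} (h : e ≠ sortedPair i j) :
    BelowAfter w (k + 1) i j ↔ BelowAfter w k i j := by
  rw [BelowAfter, BelowAfter, List.take_add_one, he]
  simp only [List.count_append, Option.toList_some, List.count_singleton]
  unfold sortedPair at h
  rcases lt_trichotomy i j with hij | rfl | hij
  · simp_all [hij.asymm]
  · simp
  · simp_all [hij.asymm]

theorem belowAfter_succ_of_eq {w : List (Fin n × Fin n)} {k : ℕ} {i j : Fin n} (hij : i ≠ j)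
    (he : w[k]? = some (sortedPair i j)) :
    BelowAfter w (k + 1) i j ↔ BelowAfter w k j i := by
  rw [BelowAfter, BelowAfter, List.take_add_one, he]
  simp only [List.count_append, Option.toList_some, List.count_singleton]
  unfold sortedPair
  rcases lt_or_gt_of_ne hij with h | h
  · simp [h, h.asymm, Nat.even_add_one]
  · simp [h, h.asymm, Nat.even_add_one]

variable {σ : List XYZ} {w : List (Fin n × Fin n)}

/-- After sorting the three labels, each case is an instance of consistency at the counts of the
first `k` crossings; if i = l, the two parities contradict each other. -/
theorem BelowAfter.trans (hσ : IsConsistent σ) (hw : IsRegularWord σ w) {k : ℕ} {i j l : Fin n}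
    (h₁ : BelowAfter w k i j) (h₂ : BelowAfter w k j l) : BelowAfter w k i l := by
  have key : ∀ {a b c : Fin n}, a < b → b < c → _ := fun hab hbc =>
    hσ _ _ _ (hw.visits (List.take_prefix k w) hab hbc)
  unfold BelowAfter at *
  rcases h₁ with ⟨h, h₁⟩ | ⟨h, h₁⟩ <;> rcases h₂ with ⟨h', h₂⟩ | ⟨h', h₂⟩
  · have := key h h'
    have := h.trans h'
    tauto
  · rcases lt_trichotomy i l with hil | rfl | hil
    · have := key hil h'
      tauto
    · exact absurd h₁ h₂
    · have := key hil h
      tauto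
  · rcases lt_trichotomy i l with hil | rfl | hil
    · have := key h hil
      tauto
    · exact absurd h₂ h₁
    · have := key h' hil
      tauto
  · have := key h' h
    have := h'.trans h
    tauto

theorem heightAfter_lt (hσ : IsConsistent σ) (hw : IsRegularWord σ w) {k : ℕ} {i j : Fin n}
    (h : BelowAfter w k i j) : heightAfter w k i < heightAfter w k j := by
  classical
  refine Finset.card_lt_card (Finset.ssubset_iff_of_subset ?_ |>.2 ⟨i, ?_, ?_⟩)
  · intro l hl
    rw [Finset.mem_filter] at hl ⊢
    exact ⟨hl.1, hl.2.trans hσ hw h⟩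
  · simpa using h
  · simpa using not_belowAfter_self w k i

theorem heightAfter_injective (hσ : IsConsistent σ) (hw : IsRegularWord σ w) (k : ℕ) :
    Function.Injective (heightAfter w k) := by
  intro i j h
  by_contra hij
  rcases belowAfter_or (w := w) (k := k) hij with h' | h'
  · exact (heightAfter_lt hσ hw h').ne h
  · exact (heightAfter_lt hσ hw h').ne' h

/-- The paths that realize the crossings of `w` one after the other, on `[0, m]` where `m` is the
number of crossings. -/
noncomputable def polygonalPath (w : List (Fin n × Fin n)) (i : Fin n) : ℝ → ℝ :=
  interpolate (fun k => heightAfter w k i) w.length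

/-- Only the pair `e` changes its order in step `k`. Any other pair has the same order at both ends
of the linear piece, hence throughout. -/
theorem polygonalPath_ne (hσ : IsConsistent σ) (hw : IsRegularWord σ w) {k : ℕ}
    {e : Fin n × Fin n} (he : w[k]? = some e) {i j : Fin n} (hij : i ≠ j)
    (h : e ≠ sortedPair i j) {u : ℝ} (h0 : 0 ≤ u) (h1 : u ≤ 1) :
    polygonalPath w i (k + u) ≠ polygonalPath w j (k + u) := by
  have key : ∀ {i j : Fin n}, e ≠ sortedPair i j → BelowAfter w k i j →
      polygonalPath w i (k + u) < polygonalPath w j (k + u) := by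
    intro i j h hb
    have hk : k < w.length := (List.getElem?_eq_some_iff.1 he).1
    rw [polygonalPath, polygonalPath, interpolate_eq _ hk h0 h1, interpolate_eq _ hk h0 h1]
    refine linear_lt ?_ ?_ h0 h1
    · exact_mod_cast heightAfter_lt hσ hw hb
    · exact_mod_cast heightAfter_lt hσ hw ((belowAfter_succ_of_ne he h).2 hb)
  rcases belowAfter_or (w := w) (k := k) hij with hb | hb
  · exact (key h hb).ne
  · refine (key ?_ hb).ne'
    intro hs
    apply h
    rw [hs]
    unfold sortedPair
    rcases lt_or_gt_of_ne hij with h | h <;> simp [h, h.asymm]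

theorem exists_polygonalPath_crossing (hσ : IsConsistent σ) (hw : IsRegularWord σ w) {k : ℕ}
    {e : Fin n × Fin n} (he : w[k]? = some e) (hlt : e.1 < e.2) :
    ∃ θ : ℝ, 0 < θ ∧ θ < 1 ∧
      (∀ u, 0 ≤ u → u ≤ 1 →
        (polygonalPath w e.1 (k + u) = polygonalPath w e.2 (k + u) ↔ u = θ)) ∧
      (((∀ u, 0 ≤ u → u < θ → polygonalPath w e.1 (k + u) < polygonalPath w e.2 (k + u)) ∧
        (∀ u, θ < u → u ≤ 1 → polygonalPath w e.2 (k + u) < polygonalPath w e.1 (k + u))) ∨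
      ((∀ u, 0 ≤ u → u < θ → polygonalPath w e.2 (k + u) < polygonalPath w e.1 (k + u)) ∧
        (∀ u, θ < u → u ≤ 1 → polygonalPath w e.1 (k + u) < polygonalPath w e.2 (k + u)))) := by
  have hk : k < w.length := (List.getElem?_eq_some_iff.1 he).1
  have key : ∀ i j : Fin n, i ≠ j → w[k]? = some (sortedPair i j) → BelowAfter w k i j →
      ∃ θ : ℝ, 0 < θ ∧ θ < 1 ∧ ∀ u, 0 ≤ u → u ≤ 1 →
        (polygonalPath w i (k + u) = polygonalPath w j (k + u) ↔ u = θ) ∧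
        (u < θ → polygonalPath w i (k + u) < polygonalPath w j (k + u)) ∧
        (θ < u → polygonalPath w j (k + u) < polygonalPath w i (k + u)) := by
    intro i j hij hw' hb
    obtain ⟨θ, h0, h1, h⟩ := exists_linear_crossing
      (x₀ := heightAfter w k i) (y₀ := heightAfter w k j) (x₁ := heightAfter w (k + 1) i)
      (y₁ := heightAfter w (k + 1) j) (by exact_mod_cast heightAfter_lt hσ hw hb)
      (by
        refine Nat.cast_lt.2 (heightAfter_lt hσ hw ?_)
        refine (belowAfter_succ_of_eq hij.symm ?_).2 hb
        rw [hw']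
        unfold sortedPair
        rcases lt_or_gt_of_ne hij with h | h <;> simp [h, h.asymm])
    refine ⟨θ, h0, h1, fun u hu hu' => ?_⟩
    rw [polygonalPath, polygonalPath, interpolate_eq _ hk hu hu', interpolate_eq _ hk hu hu']
    exact h u
  have s1 : sortedPair e.1 e.2 = e := by simp [sortedPair, hlt]
  have s2 : sortedPair e.2 e.1 = e := by simp [sortedPair, hlt.asymm]
  rcases belowAfter_or (w := w) (k := k) hlt.ne with hb | hb
  · obtain ⟨θ, h0, h1, h⟩ := key _ _ hlt.ne (by rw [s1, he]) hb
    exact ⟨θ, h0, h1, fun u hu hu' => (h u hu hu').1, Or.inl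
      ⟨fun u hu hu' => (h u hu (by linarith)).2.1 hu',
        fun u hu hu' => (h u (by linarith) hu').2.2 hu⟩⟩
  · obtain ⟨θ, h0, h1, h⟩ := key _ _ hlt.ne' (by rw [s2, he]) hb
    exact ⟨θ, h0, h1, fun u hu hu' => eq_comm.trans (h u hu hu').1, Or.inr
      ⟨fun u hu hu' => (h u hu (by linarith)).2.1 hu',
        fun u hu hu' => (h u (by linarith) hu').2.2 hu⟩⟩

end Realization

theorem exists_floor_add {m : ℕ} (hm : 0 < m) {s : ℝ} (h0 : 0 ≤ s) (h1 : s ≤ m) :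
    ∃ k < m, ∃ u : ℝ, 0 ≤ u ∧ u ≤ 1 ∧ s = k + u := by
  rcases h1.lt_or_eq with h | rfl
  · exact ⟨⌊s⌋₊, (Nat.floor_lt h0).2 h, s - ⌊s⌋₊, by linarith [Nat.floor_le h0],
      by linarith [Nat.lt_floor_add_one s], by ring⟩
  · refine ⟨m - 1, by omega, 1, zero_le_one, le_rfl, ?_⟩
    rw [Nat.cast_sub hm]
    simp

/-- The ranks of the paths are interpolated linearly between consecutive crossings, so on the `k`-th
unit interval exactly the `k`-th pair meets, once, in its interior. Nonemptiness allows rescaling by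
the length to [0,1]. Triple points cannot occur, since `T` is injective and each time carries one
pair. -/
theorem exists_pathSystem {n : ℕ} {σ : List XYZ} {w : List (Fin n × Fin n)} (hn : 3 ≤ n)
    (hσ : IsConsistent σ) (hw : IsRegularWord σ w) (hlt : ∀ e ∈ w, e.1 < e.2) (hne : w ≠ []) :
    ∃ (S : PathSystem n) (T : Fin w.length → unitInterval), StrictMono T ∧
      ∀ i j, i ≠ j → ∀ t, S.path i t = S.path j t ↔ ∃ k, w.get k = sortedPair i j ∧ t = T k := by
  have hm : 0 < w.length := List.length_pos_iff.2 hne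
  have hmR : (0 : ℝ) < w.length := Nat.cast_pos.2 hm
  have hget : ∀ k : Fin w.length, w[(k : ℕ)]? = some (w.get k) := fun k => by simp
  choose θ hθ0 hθ1 hθ hcross using fun k : Fin w.length =>
    exists_polygonalPath_crossing hσ hw (hget k) (hlt _ (List.get_mem w k))
  have hTmem : ∀ k : Fin w.length, (k + θ k) / w.length ∈ unitInterval := by
    intro k
    have hk : ((k : ℕ) : ℝ) + 1 ≤ w.length := by exact_mod_cast k.2
    exact ⟨div_nonneg (by linarith [hθ0 k, (Nat.cast_nonneg k : (0 : ℝ) ≤ (k : ℕ))]) hmR.le,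
      div_le_one_of_le₀ (by linarith [hθ1 k]) hmR.le⟩
  obtain ⟨T, hT⟩ : ∃ T : Fin w.length → unitInterval,
      ∀ k, (w.length : ℝ) * T k = k + θ k := by
    refine ⟨fun k => ⟨_, hTmem k⟩, fun k => ?_⟩
    field_simp
  have hTmono : StrictMono T := by
    intro k l hkl
    have h1 : ((k : ℕ) : ℝ) + 1 ≤ (l : ℕ) := by exact_mod_cast hkl
    have h2 : (w.length : ℝ) * T k < w.length * T l := by
      rw [hT, hT]
      linarith [hθ1 k, hθ0 l]
    exact Subtype.coe_lt_coe.1 (lt_of_mul_lt_mul_left h2 hmR.le)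
  obtain ⟨P, hP⟩ : ∃ P : Fin n → C(unitInterval, ℝ),
      ∀ i t, P i t = polygonalPath w i (w.length * t) := by
    refine ⟨fun i => ⟨fun t => polygonalPath w i (w.length * t), ?_⟩, fun _ _ => rfl⟩
    exact (continuous_interpolate _ _).comp (by fun_prop)
  have split : ∀ t : unitInterval, ∃ (k : Fin w.length) (u : ℝ), 0 ≤ u ∧ u ≤ 1 ∧
      (w.length : ℝ) * t = k + u := by
    intro t
    obtain ⟨k, hk, u, h⟩ := exists_floor_add hm (mul_nonneg hmR.le t.2.1)
      (mul_le_of_le_one_right hmR.le t.2.2)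
    exact ⟨⟨k, hk⟩, u, h⟩
  have pair : ∀ (k : Fin w.length) (i j : Fin n), w.get k = sortedPair i j →
      ((w.get k).1 = i ∧ (w.get k).2 = j) ∨ ((w.get k).1 = j ∧ (w.get k).2 = i) := by
    intro k i j h
    rw [h, sortedPair]
    split_ifs <;> simp
  have hmeet : ∀ i j, i ≠ j → ∀ t, P i t = P j t ↔
      ∃ k, w.get k = sortedPair i j ∧ t = T k := by
    intro i j hij t
    rw [hP, hP]
    have hmt : ∀ k, (w.length : ℝ) * t = k + θ k → t = T k := fun k h =>
      Subtype.ext (mul_left_cancel₀ hmR.ne' (h.trans (hT k).symm))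
    constructor
    · intro h
      obtain ⟨k, u, h0, h1, hk⟩ := split t
      rw [hk] at h
      by_cases hs : w.get k = sortedPair i j
      · refine ⟨k, hs, hmt k ?_⟩
        rw [hk]
        congr 1
        rcases pair k i j hs with ⟨h2, h3⟩ | ⟨h2, h3⟩
        · exact (hθ k u h0 h1).1 (by rwa [h2, h3])
        · exact (hθ k u h0 h1).1 (by rw [h2, h3, h])
      · exact absurd h (polygonalPath_ne hσ hw (hget k) hij hs h0 h1)
    · rintro ⟨k, hs, rfl⟩
      rw [hT]
      have := (hθ k (θ k) (hθ0 k).le (hθ1 k).le).2 rfl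
      rcases pair k i j hs with ⟨h2, h3⟩ | ⟨h2, h3⟩
      · rwa [h2, h3] at this
      · rw [h2, h3] at this
        exact this.symm
  have hP0 : ∀ i, P i 0 = heightAfter w 0 i := by
    intro i
    have := interpolate_eq (fun k => (heightAfter w k i : ℝ)) hm le_rfl zero_le_one
    simpa [hP, polygonalPath] using this
  have hP1 : ∀ i, P i 1 = heightAfter w w.length i := by
    intro i
    have := interpolate_eq (fun k => (heightAfter w k i : ℝ)) (Nat.sub_lt hm one_pos)
      zero_le_one le_rfl
    have hcast : ((w.length - 1 : ℕ) : ℝ) + 1 = w.length := by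
      exact_mod_cast Nat.sub_add_cancel hm
    rw [hcast, Nat.sub_add_cancel (show 1 ≤ w.length from hm)] at this
    simpa [hP, polygonalPath] using this
  have hcr : ∀ k : Fin w.length, CrossAt (P (w.get k).1) (P (w.get k).2) (T k) := by
    intro k
    have hcont : Continuous fun t : unitInterval => (w.length : ℝ) * t - k := by fun_prop
    have hval : (w.length : ℝ) * T k - k = θ k := by rw [hT]; ring
    have hleft : ∀ᶠ t : unitInterval in nhdsWithin (T k) (Set.Iio (T k)),
        0 ≤ (w.length : ℝ) * t - k ∧ (w.length : ℝ) * t - k < θ k := by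
      have h1 : ∀ᶠ t : unitInterval in nhdsWithin (T k) (Set.Iio (T k)), 0 < (w.length : ℝ) * t - k :=
        nhdsWithin_le_nhds (hcont.continuousAt.eventually_const_lt ((hθ0 k).trans_eq hval.symm))
      filter_upwards [h1, self_mem_nhdsWithin] with t h1 h2
      refine ⟨h1.le, ?_⟩
      rw [← hval]
      exact sub_lt_sub_right (mul_lt_mul_of_pos_left h2 hmR) _
    have hright : ∀ᶠ t : unitInterval in nhdsWithin (T k) (Set.Ioi (T k)),
        θ k < (w.length : ℝ) * t - k ∧ (w.length : ℝ) * t - k ≤ 1 := by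
      have h1 : ∀ᶠ t : unitInterval in nhdsWithin (T k) (Set.Ioi (T k)), (w.length : ℝ) * t - k < 1 :=
        nhdsWithin_le_nhds (hcont.continuousAt.eventually_lt_const (hval.trans_lt (hθ1 k)))
      filter_upwards [h1, self_mem_nhdsWithin] with t h1 h2
      refine ⟨?_, h1.le⟩
      rw [← hval]
      exact sub_lt_sub_right (mul_lt_mul_of_pos_left h2 hmR) _
    rcases hcross k with ⟨h1, h2⟩ | ⟨h1, h2⟩
    · refine Or.inl ⟨?_, ?_⟩
      · filter_upwards [hleft] with t ht
        have := h1 _ ht.1 ht.2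
        rwa [add_sub_cancel, ← hP, ← hP] at this
      · filter_upwards [hright] with t ht
        have := h2 _ ht.1 ht.2
        rwa [add_sub_cancel, ← hP, ← hP] at this
    · refine Or.inr ⟨?_, ?_⟩
      · filter_upwards [hleft] with t ht
        have := h1 _ ht.1 ht.2
        rwa [add_sub_cancel, ← hP, ← hP] at this
      · filter_upwards [hright] with t ht
        have := h2 _ ht.1 ht.2
        rwa [add_sub_cancel, ← hP, ← hP] at this
  refine ⟨⟨P, hn, ?_, ?_, ?_, ?_, ?_⟩, T, hTmono, hmeet⟩
  · intro i j hij
    simp only [hP0]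
    refine Nat.cast_lt.2 (heightAfter_lt hσ hw (Or.inl ⟨hij, ?_⟩))
    simp
  · intro i j hij
    simp only [hP1] at hij
    exact heightAfter_injective hσ hw _ (Nat.cast_injective hij)
  · intro i j hij
    refine (Set.finite_range T).subset fun t ht => ?_
    obtain ⟨k, -, rfl⟩ := (hmeet i j hij t).1 ht
    exact ⟨k, rfl⟩
  · intro i j hij t ht
    obtain ⟨k, hk, rfl⟩ := (hmeet i j hij t).1 ht
    rcases pair k i j hk with ⟨rfl, rfl⟩ | ⟨rfl, rfl⟩
    · exact hcr k
    · exact (hcr k).symm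
  · rintro i j l hij hil hjl t ⟨h1, h2⟩
    obtain ⟨k, hk, rfl⟩ := (hmeet i j hij t).1 h1
    obtain ⟨k', hk', hT'⟩ := (hmeet i l hil _).1 h2
    obtain rfl := hTmono.injective hT'
    rcases pair k i j hk with ⟨h3, h4⟩ | ⟨h3, h4⟩ <;>
    rcases pair k i l hk' with ⟨h5, h6⟩ | ⟨h5, h6⟩
    · exact hjl (h4.symm.trans h6)
    · exact hij (h6.symm.trans h4)
    · exact hij (h5.symm.trans h3)
    · exact hjl (h3.symm.trans h5)

theorem extendable_of_regularWord {σ : List XYZ} {w : List (Fin 4 × Fin 4)}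
    (hσ : IsConsistent σ) (hσ' : σ ≠ []) (hw : IsRegularWord σ w) (hlt : ∀ e ∈ w, e.1 < e.2) :
    Extendable σ := by
  classical
  have hne : w ≠ [] := by
    rintro rfl
    exact hσ' (hw 0 1 2 (by decide) (by decide)).symm
  obtain ⟨S, T, hT, hmeet⟩ := exists_pathSystem (by norm_num) hσ hw hlt hne
  have hmeet' : ∀ i j : Fin 4, i < j → ∀ k, S.path i (T k) = S.path j (T k) ↔ w.get k = (i, j) := by
    intro i j hij k
    rw [hmeet i j hij.ne, sortedPair, if_pos hij]
    exact ⟨fun ⟨l, hl, h⟩ => by rwa [hT.injective h], fun h => ⟨k, h, rfl⟩⟩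
  have hsorted : S.sortedTimes = (List.finRange w.length).map T := by
    refine List.eq_of_strictly_sorted S.pairwise_sortedTimes
      ((List.pairwise_lt_finRange _).map _ fun _ _ h => hT h) fun t => ?_
    rw [S.mem_sortedTimes]
    simp only [List.mem_map, List.mem_finRange, true_and]
    constructor
    · rintro ⟨i, j, hij, h⟩
      obtain ⟨k, -, rfl⟩ := (hmeet i j hij t).1 h
      exact ⟨k, rfl⟩
    · rintro ⟨k, rfl⟩
      have hk := hlt _ (List.get_mem w k)
      exact ⟨_, _, hk.ne, (hmeet' _ _ hk k).2 rfl⟩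
  have hsig : ∀ e : Fin 3 ↪o Fin 4, (S.restrict le_rfl e).signature = σ := by
    intro e
    have h01 : e 0 < e 1 := e.strictMono (by decide)
    have h12 : e 1 < e 2 := e.strictMono (by decide)
    have h02 := h01.trans h12
    rw [S.signature_restrict, hsorted, List.flatMap_map, ← hw _ _ _ h01 h12]
    simp only [hmeet' _ _ h01, hmeet' _ _ h02, hmeet' _ _ h12]
    conv_rhs => rw [← List.map_get_finRange w]
    rw [List.filterMap_map, List.filterMap_eq_flatMap_toList]
    congr 1
    funext k
    simp only [tripleLetter, Function.comp]
    by_cases h1 : w.get k = (e 0, e 1)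
    · simp only [h1]
      simp [h12.ne, h01.ne]
    · by_cases h2 : w.get k = (e 0, e 2)
      · simp only [h2]
        simp [h12.ne', h01.ne]
      · by_cases h3 : w.get k = (e 1, e 2)
        · simp only [h3]
          simp [h01.ne']
        · simp only [if_neg h1, if_neg h2, if_neg h3]
          rfl
  exact ⟨S, ⟨le_rfl, fun e e' => ⟨(hsig e).trans (hsig e').symm, (hsig e).trans_ne hσ'⟩⟩, hsig⟩

/-! ### Words in W associated to a signature, and the conclusion -/

theorem c_notMem_of_mem_kstar_blocksAB {ω : List ABCD} (h : ω ∈ blocksAB∗) :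
    ABCD.c ∉ ω := by
  intro hc
  obtain ⟨M, rfl, hM⟩ := Language.mem_kstar.1 h
  obtain ⟨y, hy, hcy⟩ := List.mem_flatten.1 hc
  obtain ⟨r, rfl | rfl⟩ := hM y hy <;>
    simp [BlockShape.word, BlockShape.fst, BlockShape.snd] at hcy

theorem a_notMem_of_mem_kstar_blocksCD {ω : List ABCD} (h : ω ∈ blocksCD∗) :
    ABCD.a ∉ ω := by
  intro hc
  obtain ⟨M, rfl, hM⟩ := Language.mem_kstar.1 h
  obtain ⟨y, hy, hcy⟩ := List.mem_flatten.1 hc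
  obtain ⟨r, rfl | rfl⟩ := hM y hy <;>
    simp [BlockShape.word, BlockShape.fst, BlockShape.snd] at hcy

/-- Only blocks on {c, d} contribute to row 0 and only blocks on {a, b} to row 2, so blocks of both
kinds occur with positive size. -/
theorem blocksWord_mem_wordsW {L : List (BlockShape × ℕ)} (h0 : blocksTableau 3 L 0 ≠ [])
    (h2 : blocksTableau 3 L 2 ≠ []) : blocksWord L ∈ wordsW := by
  have key : ∀ i : Fin 3, blocksTableau 3 L i ≠ [] → ∃ B ∈ L, B.1.row B.2 3 i ≠ [] := by
    intro i hi
    obtain ⟨a, ha⟩ := List.exists_mem_of_ne_nil _ hi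
    obtain ⟨B, hB, haB⟩ := List.mem_flatMap.1 ha
    exact ⟨B, hB, List.ne_nil_of_mem haB⟩
  refine ⟨(mem_kstar_iff_exists_blocksWord _).2 ⟨L, rfl⟩, fun h => ?_, fun h => ?_⟩
  · refine c_notMem_of_mem_kstar_blocksAB h ?_
    obtain ⟨⟨s, r⟩, hB, hr⟩ := key 0 h0
    refine List.mem_flatMap.2 ⟨_, hB, ?_⟩
    rcases Nat.eq_zero_or_pos r with rfl | hr0
    · exact absurd (BlockShape.row_zero _ _ _) hr
    cases s
    · exact absurd (BlockShape.row_three_ab r).1 hr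
    · exact absurd (BlockShape.row_three_ba r).1 hr
    · simp [BlockShape.word, BlockShape.fst, BlockShape.snd, hr0.ne']
    · simp [BlockShape.word, BlockShape.fst, BlockShape.snd, hr0.ne']
  · refine a_notMem_of_mem_kstar_blocksCD h ?_
    obtain ⟨⟨s, r⟩, hB, hr⟩ := key 2 h2
    refine List.mem_flatMap.2 ⟨_, hB, ?_⟩
    rcases Nat.eq_zero_or_pos r with rfl | hr0
    · exact absurd (BlockShape.row_zero _ _ _) hr
    cases s
    · simp [BlockShape.word, BlockShape.fst, BlockShape.snd, hr0.ne']
    · simp [BlockShape.word, BlockShape.fst, BlockShape.snd, hr0.ne']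
    · exact absurd (BlockShape.row_three_cd r).2.2 hr
    · exact absurd (BlockShape.row_three_dc r).2.2 hr

theorem RegularChain.exists_isAssociatedWord {N : ℕ} {σ : List XYZ}
    (h : RegularChain N (Visits σ)) (hne : σ ≠ []) (hσ : IsSignature σ) :
    ∃ ω, IsAssociatedWord σ ω := by
  obtain ⟨L, hL⟩ := h.exists_blocks
  have hcount := h.le (⟨σ, List.prefix_rfl, rfl, rfl, rfl⟩ : Visits σ _ _ _)
  have hN : 0 < N := by
    by_contra hN
    cases σ with
    | nil => exact hne rfl
    | cons l σ => cases l <;> simp at hcount <;> omega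
  obtain ⟨τ, hτ, -, hy, -⟩ := h.top
  -- A `y` leaves a letter in row 0 and in row 2, so both are nonempty.
  have hmem : XYZ.y ∈ σ := hτ.subset (List.count_pos_iff.1 (by omega))
  obtain ⟨S, rfl⟩ := hσ
  refine ⟨blocksWord L, blocksWord_mem_wordsW ?_ ?_, S, rfl, ?_⟩
  · rw [hL]
    exact List.ne_nil_of_mem (List.mem_filterMap.2 ⟨_, hmem, (rfl : sigRow 0 XYZ.y = some 2)⟩)
  · rw [hL]
    exact List.ne_nil_of_mem (List.mem_filterMap.2 ⟨_, hmem, (rfl : sigRow 2 XYZ.y = some 0)⟩)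
  · rw [wordTableau_blocksWord]
    funext i
    rw [hL, S.tableau_three]

/-- The tableau of a system of size 3 depends only on its signature, so the realizing system can be
forgotten. -/
theorem IsAssociatedWord.exists_blocks {σ : List XYZ} {ω : List ABCD} (h : IsAssociatedWord σ ω) :
    ∃ L, blocksWord L = ω ∧ ∀ i, blocksTableau 3 L i = σ.filterMap (sigRow i) := by
  obtain ⟨⟨hω, -, -⟩, S, rfl, hS⟩ := h
  obtain ⟨L, rfl⟩ := (mem_kstar_iff_exists_blocksWord ω).1 hω
  refine ⟨L, rfl, fun i => ?_⟩
  rw [← S.tableau_three, hS, wordTableau_blocksWord]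

theorem mainTheorem6 (σ : List XYZ) (hσ : IsSignature σ) (hirr : IrreducibleWord σ) :
    (Extendable σ ↔ (∃ ω, IsAssociatedWord σ ω) ∧ HasTurnFactorization σ) ∧
      ∀ (n : ℕ) (S : PathSystem n), S.IsRegularWithSignature σ →
        ∀ ω, IsAssociatedWord σ ω → S.tableau = wordTableau n ω := by
  refine ⟨⟨?_, ?_⟩, ?_⟩
  · rintro ⟨S, hS⟩
    have h := (S.isRegularWord_crossingWord hS).regularChain hirr
    exact ⟨h.exists_isAssociatedWord hirr.1 hσ, h.hasTurnFactorization hirr.1⟩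
  · rintro ⟨⟨ω, hω⟩, hturn⟩
    obtain ⟨L, -, hL⟩ := hω.exists_blocks
    obtain ⟨w, hw, hlt⟩ := exists_regularWord hL hturn
    obtain ⟨S, rfl⟩ := hσ
    exact extendable_of_regularWord S.isConsistent_signature hirr.1 hw hlt
  · intro n S hS ω hω
    obtain ⟨L, rfl, hL⟩ := hω.exists_blocks
    rw [wordTableau_blocksWord]
    exact S.tableau_eq_blocksTableau hS hL
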